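/- Fix an inverse temperature $\beta>0$ and a frequency $\omega>0$. Consider $n$ bosonic modes with quadratures $r=(x_1,\dots,x_n,p_1,\dots,p_n)$, $[x_i,p_j]=i\delta_{ij}$, Hamiltonian $\tfrac{\omega}{2}r^{T}r$, and states with vanishing first moments, described by their covariance matrix $\sigma=\big(\tfrac12\langle\{r_i,r_j\}\rangle\big)_{ij}$; covariance matrices of states are the real symmetric $\sigma$ with $\sigma+\tfrac i2\Omega\ge 0$, where $\Omega$ is the symplectic form. With $a_j=(x_j+ip_j)/\sqrt2$ and $\nu=\tfrac12\,\frac{e^{\beta\omega}+1}{e^{\beta\omega}-1}$ (the quadrature variance of the thermal state), put $$M_{ij}=\tfrac12\langle a_j^\dagger a_i+a_ia_j^\dagger\rangle-\nu\delta_{ij},\qquad A_{ij}=\langle a_ja_i\rangle .$$ Let $\mu^+_1\ge\mu^+_2\ge\dots$ be the positive eigenvalues of the Hermitian matrix $M$ and $\mu^-_1\ge\mu^-_2\ge\dots$ the absolute values of its negative eigenvalues (with multiplicity), both lists extended by zeros, and let $\alpha_1\ge\dots\ge\alpha_n\ge0$ be the singular values of the symmetric matrix $A$; primes denote the same quantities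 for $M'$, $A'$. A Gaussian thermal operation (GTO) adjoins a bath of finitely many modes with an arbitrary second-order Hamiltonian in its thermal state at inverse temperature $\beta$, applies a Gaussian unitary that preserves the total energy, and discards the bath. Write $M\to M'$ if some GTO takes a state with matrix $M$ to a state with matrix $M'$ (whatever happens to $A$), and $M\to_\delta M'$ if $M\to\tilde M$ for some $\tilde M$ with $\|M'-\tilde M\|_1\le\delta$ (trace norm); define $A\to A'$ and $A\to_\delta A'$ in the same way. Write $[x]_+=\max\{x,0\}$. Let $M,M'$ be the $M$-matrices of two $n$-mode states, let $A,A'$ be the $A$-matrices of two $n$-mode states, and let $\delta$ be a real number. 1. There is a catalyst, i.e. the $M$-matrix $M_C$ of a state of some finite positive number of modes of frequency $\omega$, with $M\oplus M_C\to_\delta M'\oplus M_C$, if and only if $$\sum_i[\mu'^+_i-\mu^+_i]_+ +\sum_i[\mu'^-_i-\mu^-_i]_+\le\delta .$$ 2. There is a catalyst, i.e. the $A$-matrix $A_C$ of a state of some finite positive number of modes of frequency $\omega$, with $A\oplus A_C\to_\delta A'\oplus A_C$, if and only if $$\sum_i[\alpha'_i-\alpha_i]_+\le\delta .$$ 3.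 There is no embezzlement: if for every $\delta>0$ there is a catalyst $M_C$ (which may depend on $\delta$) with $M\oplus M_C\to_\delta M'\oplus M_C$, then $M\to M'$ already without a catalyst and without error. Likewise, if for every $\delta>0$ there is a catalyst $A_C$ with $A\oplus A_C\to_\delta A'\oplus A_C$, then $A\to A'$. -/

import Mathlib

open scoped ComplexOrder

namespace GaussianThermal

/-! Phase space of a family of bosonic modes labelled by `ι`: the index `Sum.inl i` stands for
the quadrature `x_i` and `Sum.inr i` for `p_i`. Units are such that `[x_i, p_j] = i δ_ij` and
covariance matrices are `σ_ij = ½ ⟨{r_i, r_j}⟩`, so that the vacuum has variance `1/2`.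
All first moments vanish. -/

/-- Real matrices on the phase space of the modes `ι`. -/
abbrev PhaseMatrix (ι : Type) := Matrix (ι ⊕ ι) (ι ⊕ ι) ℝ

/-- The symplectic form `Ω`, with `[r_i, r_j] = i Ω_ij`. -/
def symplecticForm (ι : Type) [DecidableEq ι] : PhaseMatrix ι :=
  Matrix.fromBlocks 0 1 (-1) 0

/-- Covariance matrices of (Gaussian) states: real symmetric matrices that satisfy the
uncertainty principle `σ + (i/2) Ω ≥ 0`. -/
def IsCovarianceMatrix {ι : Type} [Fintype ι] [DecidableEq ι] (σ : PhaseMatrix ι) : Prop :=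
  σ.IsSymm ∧
    (σ.map Complex.ofReal +
      (Complex.I / 2) • (symplecticForm ι).map Complex.ofReal).PosSemidef

/-- The direct sum of two phase-space matrices, on the modes of both systems: the covariance
matrix of a product state, or the Hamiltonian matrix of two non-interacting systems. -/
def directSum {ι κ : Type} (σ : PhaseMatrix ι) (τ : PhaseMatrix κ) : PhaseMatrix (ι ⊕ κ) :=
  Matrix.reindex (Equiv.sumSumSumComm ι ι κ κ) (Equiv.sumSumSumComm ι ι κ κ)
    (Matrix.fromBlocks σ 0 0 τ)

/-- The covariance matrix of the first subsystem (the second one is traced out). -/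
def reduceFst {ι κ : Type} (σ : PhaseMatrix (ι ⊕ κ)) : PhaseMatrix ι :=
  σ.submatrix (Sum.map Sum.inl Sum.inl) (Sum.map Sum.inl Sum.inl)

/-- The diagonal phase-space matrix with the same entry `d i` for both quadratures of mode `i`. -/
def modeDiagonal {ι : Type} [DecidableEq ι] (d : ι → ℝ) : PhaseMatrix ι :=
  Matrix.diagonal (Sum.elim d d)

/-- The variance `ν` of each quadrature of a mode of frequency `ω` that is in the thermal state
at inverse temperature `β`. -/
noncomputable def thermalVariance (β ω : ℝ) : ℝ :=
  (1 / 2) * ((Real.exp (β * ω) + 1) / (Real.exp (β * ω) - 1))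

/-- `τ` is the covariance matrix of the thermal state `exp (-β H) / Tr exp (-β H)` of the
second-order Hamiltonian `½ rᵀ H r`. The symplectic change of quadratures `q = S r` brings the
Hamiltonian to the normal form `½ ∑ w_l (q_l² + q_l'²)` with frequencies `w_l > 0`, and the
thermal state is a product of single-mode thermal states in the normal modes `q`. -/
def IsThermalCovariance {κ : Type} [Fintype κ] [DecidableEq κ] (β : ℝ) (H τ : PhaseMatrix κ) :
    Prop :=
  ∃ S ∈ Matrix.symplecticGroup κ ℝ, ∃ w : κ → ℝ, (∀ l, 0 < w l) ∧
    H = S.transpose * modeDiagonal w * S ∧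
    S * τ * S.transpose = modeDiagonal (fun l => thermalVariance β (w l))

/-- `σ → σ'` under a Gaussian thermal operation at inverse temperature `β`, for a system of modes
of the same frequency `ω`, with Hamiltonian `½ ω rᵀ r`: a bath of finitely many modes with any
second-order Hamiltonian starts in its thermal state, a joint Gaussian unitary (with symplectic
matrix `T`) that preserves the total energy is applied, and the bath is traced out. -/
def GTO {ι : Type} [Fintype ι] [DecidableEq ι] (β ω : ℝ) (σ σ' : PhaseMatrix ι) : Prop :=
  ∃ (k : ℕ) (H τ : PhaseMatrix (Fin k)), IsThermalCovariance β H τ ∧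
    ∃ T ∈ Matrix.symplecticGroup (ι ⊕ Fin k) ℝ,
      T.transpose * directSum (ω • (1 : PhaseMatrix ι)) H * T
        = directSum (ω • (1 : PhaseMatrix ι)) H ∧
      σ' = reduceFst (T * directSum σ τ * T.transpose)

/-- The matrix `M_ij = ½ ⟨a_j† a_i + a_i a_j†⟩ - ν δ_ij` of a covariance matrix, where
`a = (x + i p) / √2`. -/
noncomputable def mMatrix {ι : Type} [DecidableEq ι] (β ω : ℝ) (σ : PhaseMatrix ι) :
    Matrix ι ι ℂ :=
  Matrix.of fun i j =>
    ((σ (Sum.inl i) (Sum.inl j) + σ (Sum.inr i) (Sum.inr j) : ℝ) : ℂ) / 2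
      + Complex.I * ((σ (Sum.inr i) (Sum.inl j) - σ (Sum.inl i) (Sum.inr j) : ℝ) : ℂ) / 2
      - (if i = j then (thermalVariance β ω : ℂ) else 0)

/-- The matrix `A_ij = ⟨a_j a_i⟩` of a covariance matrix. -/
noncomputable def aMatrix {ι : Type} (σ : PhaseMatrix ι) : Matrix ι ι ℂ :=
  Matrix.of fun i j =>
    ((σ (Sum.inl i) (Sum.inl j) - σ (Sum.inr i) (Sum.inr j) : ℝ) : ℂ) / 2
      + Complex.I * ((σ (Sum.inl i) (Sum.inr j) + σ (Sum.inr i) (Sum.inl j) : ℝ) : ℂ) / 2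

/-- `M` is the `M`-matrix of a state. -/
def IsMMatrix {ι : Type} [Fintype ι] [DecidableEq ι] (β ω : ℝ) (M : Matrix ι ι ℂ) : Prop :=
  ∃ σ : PhaseMatrix ι, IsCovarianceMatrix σ ∧ mMatrix β ω σ = M

/-- `A` is the `A`-matrix of a state. -/
def IsAMatrix {ι : Type} [Fintype ι] [DecidableEq ι] (A : Matrix ι ι ℂ) : Prop :=
  ∃ σ : PhaseMatrix ι, IsCovarianceMatrix σ ∧ aMatrix σ = A

theorem IsMMatrix.isHermitian {ι : Type} [Fintype ι] [DecidableEq ι] {β ω : ℝ}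
    {M : Matrix ι ι ℂ} (hM : IsMMatrix β ω M) : M.IsHermitian := by
  obtain ⟨σ, hσ, rfl⟩ := hM
  have h : ∀ a b, σ a b = σ b a := fun a b => (hσ.1.apply b a)
  ext i j
  simp only [Matrix.conjTranspose_apply, mMatrix, Matrix.of_apply]
  rw [h (Sum.inl j) (Sum.inl i), h (Sum.inr j) (Sum.inr i), h (Sum.inr j) (Sum.inl i),
    h (Sum.inl j) (Sum.inr i)]
  by_cases hij : i = j
  · subst hij
    apply Complex.ext <;> simp
  · apply Complex.ext <;> simp [hij, Ne.symm hij]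

/-- `M → M'`: some Gaussian thermal operation takes a state with matrix `M` to a state with
matrix `M'`, whatever happens to the matrix `A`. -/
def MTransforms {ι : Type} [Fintype ι] [DecidableEq ι] (β ω : ℝ) (M M' : Matrix ι ι ℂ) : Prop :=
  ∃ σ σ' : PhaseMatrix ι, IsCovarianceMatrix σ ∧ mMatrix β ω σ = M ∧ mMatrix β ω σ' = M' ∧
    GTO β ω σ σ'

/-- `A → A'`: some Gaussian thermal operation takes a state with matrix `A` to a state with
matrix `A'`, whatever happens to the matrix `M`. -/
def ATransforms {ι : Type} [Fintype ι] [DecidableEq ι] (β ω : ℝ) (A A' : Matrix ι ι ℂ) : Prop :=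
  ∃ σ σ' : PhaseMatrix ι, IsCovarianceMatrix σ ∧ aMatrix σ = A ∧ aMatrix σ' = A' ∧
    GTO β ω σ σ'

/-- The singular values of a square matrix in non-increasing order, extended by zeros. -/
noncomputable def singularValue {ι : Type} [Fintype ι] [DecidableEq ι] (B : Matrix ι ι ℂ)
    (i : ℕ) : ℝ :=
  (Matrix.toEuclideanLin B).singularValues i

/-- The trace norm: the sum of the singular values. -/
noncomputable def traceNorm {ι : Type} [Fintype ι] [DecidableEq ι] (B : Matrix ι ι ℂ) : ℝ :=
  ∑ i ∈ Finset.range (Fintype.card ι), singularValue B i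

/-- `M → M'` up to an error `δ` in trace norm. -/
def MTransformsApprox {ι : Type} [Fintype ι] [DecidableEq ι] (β ω δ : ℝ) (M M' : Matrix ι ι ℂ) :
    Prop :=
  ∃ N : Matrix ι ι ℂ, MTransforms β ω M N ∧ traceNorm (M' - N) ≤ δ

/-- `A → A'` up to an error `δ` in trace norm. -/
def ATransformsApprox {ι : Type} [Fintype ι] [DecidableEq ι] (β ω δ : ℝ) (A A' : Matrix ι ι ℂ) :
    Prop :=
  ∃ B : Matrix ι ι ℂ, ATransforms β ω A B ∧ traceNorm (A' - B) ≤ δ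

/-- There is a catalyst, with any positive number of modes, such that
`M ⊕ M_C → M' ⊕ M_C` up to an error `δ`. -/
def StrongCatalyticM {ι : Type} [Fintype ι] [DecidableEq ι] (β ω δ : ℝ) (M M' : Matrix ι ι ℂ) :
    Prop :=
  ∃ m : ℕ, 0 < m ∧ ∃ C : Matrix (Fin m) (Fin m) ℂ, IsMMatrix β ω C ∧
    MTransformsApprox β ω δ (Matrix.fromBlocks M 0 0 C) (Matrix.fromBlocks M' 0 0 C)

/-- There is a catalyst, with any positive number of modes, such that
`A ⊕ A_C → A' ⊕ A_C` up to an error `δ`. -/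
def StrongCatalyticA {ι : Type} [Fintype ι] [DecidableEq ι] (β ω δ : ℝ) (A A' : Matrix ι ι ℂ) :
    Prop :=
  ∃ m : ℕ, 0 < m ∧ ∃ C : Matrix (Fin m) (Fin m) ℂ, IsAMatrix C ∧
    ATransformsApprox β ω δ (Matrix.fromBlocks A 0 0 C) (Matrix.fromBlocks A' 0 0 C)

/-- `μ⁺`: the positive eigenvalues in non-increasing order, followed by zeros. -/
noncomputable def muPlus {ι : Type} [Fintype ι] [DecidableEq ι] {M : Matrix ι ι ℂ}
    (hM : M.IsHermitian) (i : Fin (Fintype.card ι)) : ℝ :=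
  max (hM.eigenvalues₀ i) 0

/-- `μ⁻`: the absolute values of the negative eigenvalues in non-increasing order, followed by
zeros. -/
noncomputable def muMinus {ι : Type} [Fintype ι] [DecidableEq ι] {M : Matrix ι ι ℂ}
    (hM : M.IsHermitian) (i : Fin (Fintype.card ι)) : ℝ :=
  max (-hM.eigenvalues₀ i.rev) 0

end GaussianThermal

open GaussianThermal

/-! Everything reduces to one fact: a Gaussian thermal operation acts as `M ↦ K M Kᴴ` and `A ↦ K A
Kᵀ` with a contraction `K`, and every contraction occurs. In the normal modes of the bath, an
energy-preserving symplectic matrix is a unitary `U` on annihilation operators that couples only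
modes of equal frequency. It therefore fixes the thermal second moments of all modes, and after
subtracting them only the system block `K` of `U` acts (`GTO.exists_contraction`). Conversely, a
contraction dilates to a unitary, realized with bath modes of frequency `ω`
(`exists_GTO_of_contraction`).

Necessity rests on counting eigenvalues above a level `t`. If `X = L Y Lᴴ + Z` with a contraction
`L`, put `S = L Y Lᴴ + Z₊`. For `t ≥ 0` the count of `X` is at most that of `S`, and the count of `L
Y Lᴴ` is at most that of `Y`. Hence the excess of the count of `X` over that of `Y`, integrated over
`t ≥ 0`, is at most `tr S - tr (L Y Lᴴ) = tr Z₊` (`levelExcess_le`). A catalyst adds the same count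
to both sides and cancels (`levelExcess_sumElim`), while for sorted spectra the integrated excess
dominates `∑ [x_i⁺ - y_i⁺]₊` (`sum_max_sub_le_levelExcess`). For `M` the bound is applied to the
matrices and to their negatives; for `A` it is applied to Hermitian dilations, whose spectrum is
`±α`.

For sufficiency, the contraction moves each eigenvalue of `M` as far towards its target as a factor
in `[0, 1]` allows, and truncates singular values in the same way (`IsMMatrix.mTransforms`,
`IsAMatrix.aTransforms`). The bound is attained with a trivial catalyst, and letting `δ → 0`
excludes embezzlement. -/

namespace GaussianThermal

open Matrix MeasureTheory

/-! ### Level counts and quadratic forms. -/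

/-- `H = V diag(d) Vᴴ` with a unitary `V`. -/
def DiagonalizedBy {ι : Type} [Fintype ι] [DecidableEq ι] (H V : Matrix ι ι ℂ) (d : ι → ℝ) :
    Prop :=
  V * Vᴴ = 1 ∧ Vᴴ * V = 1 ∧ H = V * diagonal (fun i => (d i : ℂ)) * Vᴴ

/-- The number of entries of `d` above the level `t`. -/
noncomputable def levelCount {ι : Type} [Fintype ι] (d : ι → ℝ) (t : ℝ) : ℕ :=
  Fintype.card {i // t < d i}

/-- The real quadratic form of a complex matrix. -/
noncomputable def quadForm {ι : Type} [Fintype ι] (H : Matrix ι ι ℂ) (x : ι → ℂ) : ℝ :=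
  (star x ⬝ᵥ H *ᵥ x).re

/-- If a linear map sends the positive cone of one diagonal form into that of another, then the
second form has at least as many positive coefficients. -/
theorem levelCount_le_of_pos_imp_pos {ι κ : Type} [Fintype ι] [Fintype κ]
    (d : ι → ℝ) (d' : κ → ℝ) (t : ℝ) (G : Matrix ι κ ℂ)
    (h : ∀ z : κ → ℂ, 0 < ∑ j, (d' j - t) * ‖z j‖ ^ 2 →
      0 < ∑ i, (d i - t) * ‖(G *ᵥ z) i‖ ^ 2) :
    levelCount d' t ≤ levelCount d t := by
  classical
  by_contra hlt
  rw [not_le] at hlt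
  let ext : ({j // t < d' j} → ℂ) →ₗ[ℂ] (κ → ℂ) :=
    { toFun := fun z j => if hj : t < d' j then z ⟨j, hj⟩ else 0
      map_add' := fun a b => by ext j; by_cases hj : t < d' j <;> simp [hj]
      map_smul' := fun c a => by ext j; by_cases hj : t < d' j <;> simp [hj] }
  let f : ({j // t < d' j} → ℂ) →ₗ[ℂ] ({i // t < d i} → ℂ) :=
    (LinearMap.funLeft ℂ ℂ Subtype.val) ∘ₗ (Matrix.mulVecLin G) ∘ₗ ext
  -- `f` keeps only the coordinates of `G z` where `d` exceeds `t`. If `d'` had more such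
  -- coordinates, a nonzero kernel vector would have positive `d'`-form but nonpositive `d`-form.
  have hker : LinearMap.ker f ≠ ⊥ := by
    apply LinearMap.ker_ne_bot_of_finrank_lt
    simpa [levelCount] using hlt
  obtain ⟨z, hz, hz0⟩ := (Submodule.ne_bot_iff _).1 hker
  have hpos : 0 < ∑ j, (d' j - t) * ‖ext z j‖ ^ 2 := by
    obtain ⟨⟨j, hj⟩, hzj⟩ := Function.ne_iff.1 hz0
    apply Finset.sum_pos'
    · intro k _
      by_cases hk : t < d' k
      · exact mul_nonneg (sub_nonneg.2 hk.le) (sq_nonneg _)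
      · simp [ext, hk]
    · refine ⟨j, Finset.mem_univ _, mul_pos (sub_pos.2 hj) ?_⟩
      have : ext z j = z ⟨j, hj⟩ := by simp [ext, hj]
      rw [this]
      exact pow_pos (norm_pos_iff.2 hzj) 2
  refine absurd (h _ hpos) (not_lt.2 ?_)
  apply Finset.sum_nonpos
  intro i _
  by_cases hi : t < d i
  · have : (G *ᵥ ext z) i = 0 := congrFun (LinearMap.mem_ker.1 hz) ⟨i, hi⟩
    simp [this]
  · exact mul_nonpos_of_nonpos_of_nonneg (sub_nonpos.2 (not_lt.1 hi)) (sq_nonneg _)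

section QuadForm

variable {ι κ : Type} [Fintype ι] [Fintype κ]

theorem quadForm_add (H K : Matrix ι ι ℂ) (x : ι → ℂ) :
    quadForm (H + K) x = quadForm H x + quadForm K x := by
  simp [quadForm, add_mulVec, dotProduct_add]

theorem quadForm_mul_mul_conjTranspose (H : Matrix ι ι ℂ) (L : Matrix κ ι ℂ) (x : κ → ℂ) :
    quadForm (L * H * Lᴴ) x = quadForm H (Lᴴ *ᵥ x) := by
  simp only [quadForm, star_mulVec, conjTranspose_conjTranspose, ← mulVec_mulVec,
    ← dotProduct_mulVec]

theorem _root_.Matrix.PosSemidef.quadForm_nonneg {H : Matrix ι ι ℂ} (h : H.PosSemidef)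
    (x : ι → ℂ) : 0 ≤ quadForm H x :=
  (Complex.le_def.1 (h.dotProduct_mulVec_nonneg x)).1

variable [DecidableEq ι]

theorem quadForm_diagonal (d : ι → ℝ) (x : ι → ℂ) :
    quadForm (diagonal (fun i => (d i : ℂ))) x = ∑ i, d i * ‖x i‖ ^ 2 := by
  simp only [quadForm, dotProduct, mulVec_diagonal, Complex.re_sum, Pi.star_apply]
  refine Finset.sum_congr rfl fun i _ => ?_
  rw [← Complex.normSq_eq_norm_sq, Complex.normSq_apply]
  simp
  ring

theorem quadForm_one (x : ι → ℂ) : quadForm (1 : Matrix ι ι ℂ) x = ∑ i, ‖x i‖ ^ 2 := by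
  simpa using quadForm_diagonal (fun _ : ι => (1 : ℝ)) x

theorem DiagonalizedBy.quadForm_mulVec {H V : Matrix ι ι ℂ} {d : ι → ℝ}
    (h : DiagonalizedBy H V d) (x : ι → ℂ) : quadForm H x = ∑ i, d i * ‖(Vᴴ *ᵥ x) i‖ ^ 2 := by
  rw [h.2.2, quadForm_mul_mul_conjTranspose, quadForm_diagonal]

theorem DiagonalizedBy.quadForm_one_mulVec {H V : Matrix ι ι ℂ} {d : ι → ℝ}
    (h : DiagonalizedBy H V d) (x : ι → ℂ) : quadForm 1 x = ∑ i, ‖(Vᴴ *ᵥ x) i‖ ^ 2 := by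
  rw [← quadForm_one, ← quadForm_mul_mul_conjTranspose, mul_one, h.1]

/-- The inertia argument of `levelCount_le_of_pos_imp_pos`, read in eigencoordinates. It serves both
operator inequalities (`L = 1`) and compressions by a contraction. -/
theorem DiagonalizedBy.levelCount_le [DecidableEq κ] {H V : Matrix ι ι ℂ} {d : ι → ℝ}
    {H' V' : Matrix κ κ ℂ} {d' : κ → ℝ}
    (h : DiagonalizedBy H V d) (h' : DiagonalizedBy H' V' d') (t : ℝ) (L : Matrix ι κ ℂ)
    (hL : ∀ x, t * quadForm 1 x < quadForm H' x →
      t * quadForm 1 (L *ᵥ x) < quadForm H (L *ᵥ x)) :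
    levelCount d' t ≤ levelCount d t := by
  refine levelCount_le_of_pos_imp_pos d d' t (Vᴴ * L * V') fun z hz => ?_
  have := hL (V' *ᵥ z) (by
    rw [h'.quadForm_mulVec, h'.quadForm_one_mulVec, mulVec_mulVec, h'.2.1, one_mulVec]
    simp only [sub_mul, Finset.sum_sub_distrib, ← Finset.mul_sum] at hz
    linarith)
  rw [h.quadForm_mulVec, h.quadForm_one_mulVec, mulVec_mulVec, mulVec_mulVec] at this
  simp only [sub_mul, Finset.sum_sub_distrib, ← Finset.mul_sum]
  linarith

theorem _root_.Matrix.IsHermitian.diagonalizedBy {H : Matrix ι ι ℂ} (h : H.IsHermitian) :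
    DiagonalizedBy H (h.eigenvectorUnitary : Matrix ι ι ℂ) h.eigenvalues := by
  refine ⟨?_, ?_, ?_⟩
  · exact Unitary.coe_mul_star_self h.eigenvectorUnitary
  · exact Unitary.coe_star_mul_self h.eigenvectorUnitary
  · have := h.spectral_theorem
    rw [Unitary.conjStarAlgAut_apply] at this
    exact this

theorem DiagonalizedBy.isHermitian {H V : Matrix ι ι ℂ} {d : ι → ℝ} (h : DiagonalizedBy H V d) :
    H.IsHermitian := by
  rw [h.2.2, IsHermitian, conjTranspose_mul, conjTranspose_mul, conjTranspose_conjTranspose,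
    diagonal_conjTranspose, Matrix.mul_assoc]
  congr
  ext i
  simp

theorem DiagonalizedBy.trace_eq {H V : Matrix ι ι ℂ} {d : ι → ℝ} (h : DiagonalizedBy H V d) :
    H.trace = ((∑ i, d i : ℝ) : ℂ) := by
  rw [h.2.2, trace_mul_comm, ← Matrix.mul_assoc, h.2.1, Matrix.one_mul, trace_diagonal]
  simp

theorem DiagonalizedBy.posSemidef {H V : Matrix ι ι ℂ} {d : ι → ℝ} (h : DiagonalizedBy H V d)
    (hd : ∀ i, 0 ≤ d i) : H.PosSemidef := by
  rw [h.2.2]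
  refine PosSemidef.mul_mul_conjTranspose_same ?_ V
  exact PosSemidef.diagonal fun i => by simpa using hd i

theorem DiagonalizedBy.neg {H V : Matrix ι ι ℂ} {d : ι → ℝ} (h : DiagonalizedBy H V d) :
    DiagonalizedBy (-H) V (-d) := by
  refine ⟨h.1, h.2.1, ?_⟩
  rw [h.2.2]
  simp [← Matrix.diagonal_neg]

theorem DiagonalizedBy.fromBlocks [DecidableEq κ] {H V : Matrix ι ι ℂ} {d : ι → ℝ}
    {H' V' : Matrix κ κ ℂ} {d' : κ → ℝ} (h : DiagonalizedBy H V d) (h' : DiagonalizedBy H' V' d') :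
    DiagonalizedBy (Matrix.fromBlocks H 0 0 H') (Matrix.fromBlocks V 0 0 V') (Sum.elim d d') := by
  refine ⟨?_, ?_, ?_⟩
  · simp [fromBlocks_conjTranspose, fromBlocks_multiply, h.1, h'.1]
  · simp [fromBlocks_conjTranspose, fromBlocks_multiply, h.2.1, h'.2.1]
  · have : diagonal (fun i => ((Sum.elim d d' i : ℝ) : ℂ)) =
        Matrix.fromBlocks (diagonal (fun i => (d i : ℂ))) 0 0 (diagonal (fun i => (d' i : ℂ))) := by
      rw [fromBlocks_diagonal]
      congr
      ext (i | i) <;> simp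
    rw [this, fromBlocks_conjTranspose, fromBlocks_multiply, fromBlocks_multiply]
    simp [← h.2.2, ← h'.2.2]

end QuadForm

theorem levelCount_sumElim {ι κ : Type} [Fintype ι] [Fintype κ] (d : ι → ℝ) (d' : κ → ℝ) (t : ℝ) :
    levelCount (Sum.elim d d') t = levelCount d t + levelCount d' t := by
  classical
  rw [levelCount, Fintype.card_congr Equiv.subtypeSum, Fintype.card_sum]
  rfl

theorem levelCount_comp_equiv {ι κ : Type} [Fintype ι] [Fintype κ] (e : κ ≃ ι) (d : ι → ℝ)
    (t : ℝ) : levelCount (d ∘ e) t = levelCount d t :=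
  Fintype.card_congr (e.subtypeEquiv fun _ => Iff.rfl)

theorem levelCount_eq_sum {ι : Type} [Fintype ι] (d : ι → ℝ) (t : ℝ) :
    (levelCount d t : ℝ) = ∑ i, (Set.Iio (d i)).indicator (1 : ℝ → ℝ) t := by
  classical
  simp [levelCount, Fintype.card_subtype, Set.indicator_apply]

/-! ### Integrated level counts and the spectral perturbation bound. -/

section Integral

/-- The half-line indicators are not integrable separately; their difference is supported on a
bounded interval. -/
theorem indicator_Iio_sub (a b : ℝ) :
    (fun t => (Set.Iio a).indicator (1 : ℝ → ℝ) t - (Set.Iio b).indicator (1 : ℝ → ℝ) t) =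
      fun t => (Set.Ico b a).indicator (1 : ℝ → ℝ) t - (Set.Ico a b).indicator (1 : ℝ → ℝ) t := by
  funext t
  simp only [Set.indicator_apply, Set.mem_Iio, Set.mem_Ico, Pi.one_apply]
  grind

theorem integrable_indicator_Ico (a b : ℝ) :
    Integrable (fun t => (Set.Ico a b).indicator (1 : ℝ → ℝ) t) :=
  (integrable_indicator_iff measurableSet_Ico).2 (integrableOn_const (by simp))

theorem integral_indicator_Ico (a b : ℝ) :
    ∫ t, (Set.Ico a b).indicator (1 : ℝ → ℝ) t = max (b - a) 0 := by
  rw [integral_indicator_one measurableSet_Ico]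
  simp [Measure.real, ENNReal.toReal_ofReal']

variable {ι : Type} [Fintype ι]

theorem integrable_levelCount_sub (x y : ι → ℝ) :
    Integrable (fun t => (levelCount x t : ℝ) - levelCount y t) := by
  simp only [levelCount_eq_sum, ← Finset.sum_sub_distrib]
  refine integrable_finsetSum _ fun i _ => ?_
  rw [indicator_Iio_sub]
  exact (integrable_indicator_Ico _ _).sub (integrable_indicator_Ico _ _)

theorem integral_levelCount_sub (x y : ι → ℝ) :
    ∫ t, ((levelCount x t : ℝ) - levelCount y t) = ∑ i, x i - ∑ i, y i := by
  have h : ∀ i, Integrable (fun t => (Set.Iio (x i)).indicator (1 : ℝ → ℝ) t -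
      (Set.Iio (y i)).indicator (1 : ℝ → ℝ) t) := fun i => by
    rw [indicator_Iio_sub]
    exact (integrable_indicator_Ico _ _).sub (integrable_indicator_Ico _ _)
  simp only [levelCount_eq_sum, ← Finset.sum_sub_distrib]
  rw [integral_finsetSum _ fun i _ => h i]
  refine Finset.sum_congr rfl fun i _ => ?_
  rw [indicator_Iio_sub, integral_sub (integrable_indicator_Ico _ _)
    (integrable_indicator_Ico _ _), integral_indicator_Ico, integral_indicator_Ico]
  grind

/-- The total amount by which the level counts of `x` exceed those of `y` at levels `t ≥ 0`. -/
noncomputable def levelExcess (x y : ι → ℝ) : ℝ :=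
  ∫ t in Set.Ici (0 : ℝ), max ((levelCount x t : ℝ) - levelCount y t) 0

/-- Layer-cake argument: each summand is the measure of the levels `t ≥ 0` between `y i` and `x i`.
Sorting makes the superlevel sets nested initial segments, so at each level at most one sign of
discrepancy occurs. -/
theorem sum_max_sub_le_levelExcess {n : ℕ} {x y : Fin n → ℝ} (hx : Antitone x)
    (hy : Antitone y) : ∑ i, max (max (x i) 0 - max (y i) 0) 0 ≤ levelExcess x y := by
  have key : ∀ i, max (max (x i) 0 - max (y i) 0) 0 = ∫ t in Set.Ici (0 : ℝ),
      (Set.Ico (max (y i) 0) (max (x i) 0)).indicator (1 : ℝ → ℝ) t := fun i => by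
    rw [setIntegral_eq_integral_of_forall_compl_eq_zero, integral_indicator_Ico]
    intro t ht
    rw [Set.indicator_of_notMem]
    intro h
    exact ht ((le_max_right _ _).trans h.1)
  simp only [key]
  rw [← integral_finsetSum _ fun i _ => (integrable_indicator_Ico _ _).integrableOn]
  refine setIntegral_mono_on (integrable_finsetSum _ fun i _ =>
    (integrable_indicator_Ico _ _).integrableOn) ?_ measurableSet_Ici ?_
  · exact (integrable_levelCount_sub x y).pos_part.integrableOn
  · intro t ht
    have h1 : ∀ i, (Set.Ico (max (y i) 0) (max (x i) 0)).indicator (1 : ℝ → ℝ) t =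
        if y i ≤ t ∧ t < x i then 1 else 0 := fun i => by
      have : (0 : ℝ) ≤ t := ht
      simp only [Set.indicator_apply, Set.mem_Ico, Pi.one_apply]
      grind
    simp only [h1]
    -- Either the superlevel set of `x` lies in that of `y` and no index contributes, or the
    -- inclusion is reversed and the sum is exactly the difference of the counts.
    by_cases hsub : ∀ i, t < x i → t < y i
    · rw [Finset.sum_eq_zero]
      · exact le_max_right _ _
      · intro i _
        rw [if_neg]
        intro h
        exact absurd (hsub i h.2) (not_lt.2 h.1)
    · push Not at hsub
      obtain ⟨j, hj, hj'⟩ := hsub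
      refine le_trans (le_of_eq ?_) (le_max_left _ _)
      rw [levelCount_eq_sum, levelCount_eq_sum, ← Finset.sum_sub_distrib]
      refine Finset.sum_congr rfl fun i _ => ?_
      simp only [Set.indicator_apply, Set.mem_Iio, Pi.one_apply]
      rcases le_total i j with h | h
      · have := hx h
        grind
      · have := hy h
        grind

variable [DecidableEq ι]

/-- Spectral perturbation bound: the excess of the spectrum of `X` over that of `Y` is at most
the trace of the positive part of `X - L Y Lᴴ`, for any contraction `L`. -/
theorem levelExcess_le {X Y Z L U V W : Matrix ι ι ℂ} {x y z : ι → ℝ}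
    (hX : DiagonalizedBy X U x) (hY : DiagonalizedBy Y V y) (hZ : DiagonalizedBy Z W z)
    (hL : (1 - L * Lᴴ).PosSemidef) (hXYZ : X = L * Y * Lᴴ + Z) :
    levelExcess x y ≤ ∑ i, max (z i) 0 := by
  set P : Matrix ι ι ℂ := W * diagonal (fun i => ((max (z i) 0 : ℝ) : ℂ)) * Wᴴ with hPdef
  set Q : Matrix ι ι ℂ := W * diagonal (fun i => ((max (-z i) 0 : ℝ) : ℂ)) * Wᴴ with hQdef
  have hP : DiagonalizedBy P W (fun i => max (z i) 0) := ⟨hZ.1, hZ.2.1, rfl⟩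
  have hQ : DiagonalizedBy Q W (fun i => max (-z i) 0) := ⟨hZ.1, hZ.2.1, rfl⟩
  have hZPQ : Z + Q = P := by
    rw [hZ.2.2, hPdef, hQdef, ← Matrix.add_mul, ← Matrix.mul_add, diagonal_add]
    congr
    ext i
    rw [← Complex.ofReal_add]
    congr 1
    grind
  have hPp := hP.posSemidef fun i => le_max_right _ _
  have hQp := hQ.posSemidef fun i => le_max_right _ _
  have hYh : (L * Y * Lᴴ).IsHermitian := isHermitian_mul_mul_conjTranspose _ hY.isHermitian
  have hSh : (L * Y * Lᴴ + P).IsHermitian := hYh.add hPp.1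
  have hcount1 : ∀ t, levelCount x t ≤ levelCount hSh.eigenvalues t := fun t => by
    refine hSh.diagonalizedBy.levelCount_le hX t 1 fun v hv => ?_
    rw [one_mulVec]
    refine hv.trans_le ?_
    rw [← hZPQ, ← add_assoc, ← hXYZ, quadForm_add]
    linarith [hQp.quadForm_nonneg v]
  have hcount2 : ∀ t, levelCount hYh.eigenvalues t ≤ levelCount hSh.eigenvalues t := fun t => by
    refine hSh.diagonalizedBy.levelCount_le hYh.diagonalizedBy t 1 fun v hv => ?_
    rw [one_mulVec]
    refine hv.trans_le ?_
    rw [quadForm_add]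
    linarith [hPp.quadForm_nonneg v]
  -- The contraction gives `t ‖Lᴴ v‖² ≤ t ‖v‖²` only for `t ≥ 0`; this is why the excess ignores
  -- negative levels.
  have hcount3 : ∀ t, 0 ≤ t → levelCount hYh.eigenvalues t ≤ levelCount y t := fun t ht => by
    refine hY.levelCount_le hYh.diagonalizedBy t Lᴴ fun v hv => ?_
    rw [← quadForm_mul_mul_conjTranspose, ← quadForm_mul_mul_conjTranspose, mul_one]
    refine lt_of_le_of_lt (mul_le_mul_of_nonneg_left ?_ ht) hv
    have := hL.quadForm_nonneg v
    have h1 := quadForm_add (1 - L * Lᴴ) (L * Lᴴ) v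
    rw [sub_add_cancel] at h1
    linarith
  have hint := integrable_levelCount_sub hSh.eigenvalues hYh.eigenvalues
  calc levelExcess x y
      ≤ ∫ t in Set.Ici (0 : ℝ),
          ((levelCount hSh.eigenvalues t : ℝ) - levelCount hYh.eigenvalues t) := by
        refine setIntegral_mono_on (integrable_levelCount_sub x y).pos_part.integrableOn
          hint.integrableOn measurableSet_Ici fun t ht => ?_
        have h1 : (levelCount x t : ℝ) ≤ _ := Nat.cast_le.2 (hcount1 t)
        have h2 : (levelCount hYh.eigenvalues t : ℝ) ≤ _ := Nat.cast_le.2 (hcount2 t)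
        have h3 : (levelCount hYh.eigenvalues t : ℝ) ≤ _ := Nat.cast_le.2 (hcount3 t ht)
        apply max_le <;> linarith
    -- Since `L Y Lᴴ ≤ S`, the integrand is nonnegative at every level, so the domain may grow to
    -- the whole line, where the integral becomes a difference of traces.
    _ ≤ ∫ t, ((levelCount hSh.eigenvalues t : ℝ) - levelCount hYh.eigenvalues t) := by
        refine setIntegral_le_integral hint (Filter.Eventually.of_forall fun t => ?_)
        exact sub_nonneg.2 (Nat.cast_le.2 (hcount2 t))
    _ = ∑ i, max (z i) 0 := by
        rw [integral_levelCount_sub, sub_eq_iff_eq_add]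
        have h := trace_add (L * Y * Lᴴ) P
        rw [hSh.diagonalizedBy.trace_eq, hYh.diagonalizedBy.trace_eq, hP.trace_eq,
          ← Complex.ofReal_add, Complex.ofReal_inj] at h
        rw [h, add_comm]

end Integral

theorem levelExcess_comp_equiv {ι κ : Type} [Fintype ι] [Fintype κ] (e : κ ≃ ι) (x y : ι → ℝ) :
    levelExcess (x ∘ e) (y ∘ e) = levelExcess x y := by
  simp only [levelExcess, levelCount_comp_equiv]

/-- This is why catalysts do not help: their eigenvalues enter both counts equally and cancel level
by level. -/
theorem levelExcess_sumElim {ι κ : Type} [Fintype ι] [Fintype κ] (x y : ι → ℝ) (c : κ → ℝ) :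
    levelExcess (Sum.elim x c) (Sum.elim y c) = levelExcess x y := by
  simp only [levelExcess, levelCount_sumElim, Nat.cast_add, add_sub_add_right_eq_sub]

theorem exists_equiv_comp_of_map_univ_eq {ι κ α : Type} [Fintype ι] [Fintype κ] {f : ι → α}
    {g : κ → α} (h : Multiset.map f Finset.univ.val = Multiset.map g Finset.univ.val) :
    ∃ e : ι ≃ κ, ∀ i, f i = g (e i) := by
  classical
  have hc : ∀ c, Fintype.card {i // f i = c} = Fintype.card {i // g i = c} := fun c => by
    have := congrArg (Multiset.count c) h
    rw [Multiset.count_map, Multiset.count_map] at this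
    simp only [Fintype.card_subtype, Finset.card_def, Finset.filter_val, eq_comm (b := c)]
    exact this
  let E : (Σ c, {i // f i = c}) ≃ (Σ c, {i // g i = c}) :=
    Equiv.sigmaCongrRight fun c => Fintype.equivOfCardEq (hc c)
  refine ⟨(Equiv.sigmaFiberEquiv f).symm.trans (E.trans (Equiv.sigmaFiberEquiv g)), fun i => ?_⟩
  exact ((Fintype.equivOfCardEq (hc (f i))) ⟨i, rfl⟩).2.symm

theorem diagonal_ofReal_conjTranspose {ι : Type} [DecidableEq ι] (a : ι → ℝ) :
    (diagonal (fun i => (a i : ℂ)))ᴴ = diagonal (fun i => (a i : ℂ)) := by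
  rw [diagonal_conjTranspose]
  congr
  ext i
  simp

/-! ### Singular values, trace norm and Hermitian dilations. -/

section Singular

variable {ι κ : Type} [Fintype ι] [DecidableEq ι] [Fintype κ] [DecidableEq κ]

/-- Both lists are the roots of the characteristic polynomial with multiplicity. -/
theorem DiagonalizedBy.exists_equiv_eigenvalues₀ {H V : Matrix ι ι ℂ} {d : ι → ℝ}
    (h : DiagonalizedBy H V d) (hH : H.IsHermitian) :
    ∃ e : Fin (Fintype.card ι) ≃ ι, ∀ i, hH.eigenvalues₀ i = d (e i) := by
  have h1 : H.charpoly.roots = Multiset.map (fun i => (d i : ℂ)) Finset.univ.val := by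
    conv_lhs => rw [h.2.2, charpoly_mul_comm, ← Matrix.mul_assoc, h.2.1, Matrix.one_mul,
      charpoly_diagonal]
    rw [← Polynomial.roots_multiset_prod_X_sub_C (Multiset.map _ _), Multiset.map_map]
    rfl
  rw [hH.roots_charpoly_eq_eigenvalues₀] at h1
  obtain ⟨e, he⟩ := exists_equiv_comp_of_map_univ_eq h1
  exact ⟨e, fun i => Complex.ofReal_injective (he i)⟩

theorem eigenvalues_congr {E : Type} [NormedAddCommGroup E] [InnerProductSpace ℂ E]
    [FiniteDimensional ℂ E] {T T' : E →ₗ[ℂ] E} (hT : T.IsSymmetric) (hT' : T'.IsSymmetric) {k : ℕ}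
    (hk : Module.finrank ℂ E = k) (h : T = T') : hT.eigenvalues hk = hT'.eigenvalues hk := by
  subst h
  rfl

theorem singularValue_eq_sqrt (A : Matrix ι ι ℂ) (i : Fin (Fintype.card ι)) :
    singularValue A (i : ℕ) = √((isHermitian_conjTranspose_mul_self A).eigenvalues₀ i) := by
  have h : toEuclideanLin (Aᴴ * A) =
      LinearMap.adjoint (toEuclideanLin A) ∘ₗ toEuclideanLin A := by
    rw [toLpLin_mul_same, toEuclideanLin_conjTranspose_eq_adjoint]
  have hk : Module.finrank ℂ (EuclideanSpace ℂ ι) = Fintype.card ι := finrank_euclideanSpace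
  refine (LinearMap.singularValues_fin (toEuclideanLin A) hk i).trans (congrArg Real.sqrt ?_)
  exact (congrFun (eigenvalues_congr (isSymmetric_toEuclideanLin_iff.mpr
    (isHermitian_conjTranspose_mul_self A)) _ hk h) i).symm

theorem exists_equiv_singularValue {A V : Matrix ι ι ℂ} {a : ι → ℝ} (ha : ∀ i, 0 ≤ a i)
    (h : DiagonalizedBy (Aᴴ * A) V (fun i => a i ^ 2)) :
    ∃ e : Fin (Fintype.card ι) ≃ ι,
      ∀ i : Fin (Fintype.card ι), singularValue A (i : ℕ) = a (e i) := by
  obtain ⟨e, he⟩ := h.exists_equiv_eigenvalues₀ (isHermitian_conjTranspose_mul_self A)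
  exact ⟨e, fun i => by rw [singularValue_eq_sqrt, he, Real.sqrt_sq (ha _)]⟩

theorem traceNorm_eq_sum {A V : Matrix ι ι ℂ} {a : ι → ℝ} (ha : ∀ i, 0 ≤ a i)
    (h : DiagonalizedBy (Aᴴ * A) V (fun i => a i ^ 2)) : traceNorm A = ∑ i, a i := by
  obtain ⟨e, he⟩ := exists_equiv_singularValue ha h
  rw [traceNorm, ← Fin.sum_univ_eq_sum_range (fun i => singularValue A i), ← e.sum_comp]
  exact Finset.sum_congr rfl fun i _ => he i

theorem DiagonalizedBy.traceNorm_eq {H V : Matrix ι ι ℂ} {d : ι → ℝ} (h : DiagonalizedBy H V d) :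
    traceNorm H = ∑ i, |d i| := by
  refine traceNorm_eq_sum (V := V) (fun i => abs_nonneg _) ⟨h.1, h.2.1, ?_⟩
  rw [h.isHermitian.eq]
  conv_lhs => rw [h.2.2]
  have h1 := h.2.1
  calc V * diagonal (fun i => (d i : ℂ)) * Vᴴ * (V * diagonal (fun i => (d i : ℂ)) * Vᴴ)
      = V * (diagonal (fun i => (d i : ℂ)) * (Vᴴ * V) * diagonal (fun i => (d i : ℂ))) * Vᴴ := by
        simp only [Matrix.mul_assoc]
    _ = _ := by
        rw [h1, Matrix.mul_one, diagonal_mul_diagonal]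
        congr
        ext i
        rw [← Complex.ofReal_mul, ← sq, ← sq_abs]

/-- `A = U diag(a) Uᵀ` with a unitary `U` and `a ≥ 0`. -/
def TakagiBy (A U : Matrix ι ι ℂ) (a : ι → ℝ) : Prop :=
  U * Uᴴ = 1 ∧ Uᴴ * U = 1 ∧ (∀ i, 0 ≤ a i) ∧ A = U * diagonal (fun i => (a i : ℂ)) * Uᵀ

theorem transpose_mul_conjTranspose_transpose {U : Matrix ι ι ℂ} (h : Uᴴ * U = 1) :
    Uᵀ * Uᴴᵀ = 1 := by
  rw [← transpose_mul, h, transpose_one]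

theorem conjTranspose_transpose_mul_transpose {U : Matrix ι ι ℂ} (h : U * Uᴴ = 1) :
    Uᴴᵀ * Uᵀ = 1 := by
  rw [← transpose_mul, h, transpose_one]

theorem TakagiBy.conjTranspose_eq {A U : Matrix ι ι ℂ} {a : ι → ℝ} (h : TakagiBy A U a) :
    Aᴴ = Uᴴᵀ * diagonal (fun i => (a i : ℂ)) * Uᴴ := by
  conv_lhs => rw [h.2.2.2, conjTranspose_mul, conjTranspose_mul, diagonal_ofReal_conjTranspose]
  rw [Matrix.mul_assoc]
  rfl

/-- Here `Uᴴᵀ` is the entrywise conjugate of `U`. The inner unitaries cancel in `Aᴴ * A`, which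
identifies the Takagi coefficients as singular values. -/
theorem TakagiBy.diagonalizedBy {A U : Matrix ι ι ℂ} {a : ι → ℝ} (h : TakagiBy A U a) :
    DiagonalizedBy (Aᴴ * A) Uᴴᵀ (fun i => a i ^ 2) := by
  have h2 : Uᴴᵀᴴ = Uᵀ := by
    ext i j; simp
  refine ⟨?_, ?_, ?_⟩
  · rw [h2]; exact conjTranspose_transpose_mul_transpose h.1
  · rw [h2]; exact transpose_mul_conjTranspose_transpose h.2.1
  · rw [h.conjTranspose_eq, h2]
    conv_lhs => rw [h.2.2.2]
    calc Uᴴᵀ * diagonal (fun i => (a i : ℂ)) * Uᴴ * (U * diagonal (fun i => (a i : ℂ)) * Uᵀ)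
        = Uᴴᵀ * (diagonal (fun i => (a i : ℂ)) * (Uᴴ * U) * diagonal (fun i => (a i : ℂ))) *
            Uᵀ := by
          simp only [Matrix.mul_assoc]
      _ = _ := by
          rw [h.2.1, Matrix.mul_one, diagonal_mul_diagonal]
          congr
          ext i
          push_cast
          ring

theorem TakagiBy.fromBlocks {A U : Matrix ι ι ℂ} {a : ι → ℝ} {B V : Matrix κ κ ℂ} {b : κ → ℝ}
    (h : TakagiBy A U a) (h' : TakagiBy B V b) :
    TakagiBy (Matrix.fromBlocks A 0 0 B) (Matrix.fromBlocks U 0 0 V) (Sum.elim a b) := by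
  refine ⟨?_, ?_, ?_, ?_⟩
  · simp [fromBlocks_conjTranspose, fromBlocks_multiply, h.1, h'.1]
  · simp [fromBlocks_conjTranspose, fromBlocks_multiply, h.2.1, h'.2.1]
  · rintro (i | i)
    exacts [h.2.2.1 i, h'.2.2.1 i]
  · have : diagonal (fun i => ((Sum.elim a b i : ℝ) : ℂ)) =
        Matrix.fromBlocks (diagonal (fun i => (a i : ℂ))) 0 0 (diagonal (fun i => (b i : ℂ))) := by
      rw [fromBlocks_diagonal]
      congr
      ext (i | i) <;> simp
    rw [this, fromBlocks_transpose, fromBlocks_multiply, fromBlocks_multiply]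
    simp [← h.2.2.2, ← h'.2.2.2]

/-- The Hermitian dilation of `A`. -/
def hermitianDilation (A : Matrix ι ι ℂ) : Matrix (ι ⊕ ι) (ι ⊕ ι) ℂ :=
  Matrix.fromBlocks 0 A Aᴴ 0

/-- For a column `u` of `U` one has `A ū = a u` and `Aᴴ u = a ū`, so `(u, ±ū)/√2` are orthonormal
eigenvectors with eigenvalues `±a`. -/
theorem TakagiBy.hermitianDilation {A U : Matrix ι ι ℂ} {a : ι → ℝ} (h : TakagiBy A U a) :
    ∃ W, DiagonalizedBy (hermitianDilation A) W (Sum.elim a (-a)) := by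
  obtain ⟨s, hs, hs'⟩ : ∃ s : ℂ, star s = s ∧ s * s = 1 / 2 := by
    refine ⟨((√2)⁻¹ : ℝ), Complex.conj_ofReal _, ?_⟩
    rw [← Complex.ofReal_mul, ← mul_inv, Real.mul_self_sqrt (by norm_num)]
    norm_num
  have h2 : Uᴴᵀᴴ = Uᵀ := by
    ext i j; simp
  have half : ∀ B : Matrix ι ι ℂ, (1 / 2 : ℂ) • (B + B) = B := fun B => by
    rw [← two_smul ℂ B, smul_smul]; norm_num
  have h3 := transpose_mul_conjTranspose_transpose h.2.1
  have h4 := conjTranspose_transpose_mul_transpose h.1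
  set D := diagonal (fun i => (a i : ℂ)) with hD
  have hWH : (s • Matrix.fromBlocks U U Uᴴᵀ (-Uᴴᵀ))ᴴ = s • Matrix.fromBlocks Uᴴ Uᵀ Uᴴ (-Uᵀ) := by
    rw [conjTranspose_smul, hs, fromBlocks_conjTranspose, conjTranspose_neg, h2]
  refine ⟨s • Matrix.fromBlocks U U Uᴴᵀ (-Uᴴᵀ), ?_, ?_, ?_⟩
  · rw [hWH, smul_mul_smul_comm, hs', fromBlocks_multiply, fromBlocks_smul]
    simp [h.1, h4, half, -one_div, -smul_add]
  · rw [hWH, smul_mul_smul_comm, hs', fromBlocks_multiply, fromBlocks_smul]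
    simp [h.2.1, h3, half, -one_div, -smul_add]
  · have : diagonal (fun i => ((Sum.elim a (-a) i : ℝ) : ℂ)) = Matrix.fromBlocks D 0 0 (-D) := by
      rw [hD, diagonal_neg, fromBlocks_diagonal]
      congr
      ext (i | i) <;> simp
    rw [hWH, this, smul_mul_assoc, smul_mul_smul_comm, hs', fromBlocks_multiply,
      fromBlocks_multiply, fromBlocks_smul, GaussianThermal.hermitianDilation, h.conjTranspose_eq,
      ← hD]
    conv_lhs => rw [h.2.2.2, ← hD]
    simp [half, -one_div, -smul_add]

end Singular

/-! ### Takagi factorization. -/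

section Takagi

open scoped InnerProductSpace

variable {E : Type} [NormedAddCommGroup E] [InnerProductSpace ℂ E]

/-- The square of the antilinear `T` is complex linear and so has an eigenvector `w` in `W`. The
symmetry gives `μ ‖w‖² = ‖T w‖²`, hence `μ = s²`, and `T w + s w` satisfies the required equation.
-/
theorem exists_coneigenvector_mem (T : E →ₗ⋆[ℂ] E)
    (hT : ∀ v w, ⟪v, T w⟫_ℂ = ⟪w, T v⟫_ℂ) (W : Submodule ℂ E) [FiniteDimensional ℂ W]
    (hW : W ≠ ⊥) (hTW : ∀ w ∈ W, T w ∈ W) :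
    ∃ v ∈ W, ‖v‖ = 1 ∧ ∃ s : ℝ, 0 ≤ s ∧ T v = (s : ℂ) • v := by
  suffices h : ∃ v ∈ W, v ≠ 0 ∧ ∃ s : ℝ, 0 ≤ s ∧ T v = (s : ℂ) • v by
    obtain ⟨v, hv, hv0, s, hs, hTv⟩ := h
    refine ⟨((‖v‖⁻¹ : ℝ) : ℂ) • v, W.smul_mem _ hv, ?_, s, hs, ?_⟩
    · rw [norm_smul, Complex.norm_real, norm_inv, norm_norm]
      exact inv_mul_cancel₀ (norm_ne_zero_iff.2 hv0)
    · rw [map_smulₛₗ, hTv, Complex.conj_ofReal, smul_comm]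
  let S : E →ₗ[ℂ] E := T.comp T
  have hS : ∀ w ∈ W, S w ∈ W := fun w hw => hTW _ (hTW _ hw)
  have : Nontrivial W := Submodule.nontrivial_iff_ne_bot.2 hW
  obtain ⟨μ, hμ⟩ := Module.End.exists_eigenvalue (S.restrict hS)
  obtain ⟨⟨w, hw⟩, hwv⟩ := hμ.exists_hasEigenvector
  have hw0 : w ≠ 0 := fun h => hwv.2 (Subtype.ext h)
  have hTT : T (T w) = μ • w := congrArg Subtype.val hwv.apply_eq_smul
  have hn : ‖w‖ ≠ 0 := norm_ne_zero_iff.2 hw0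
  obtain ⟨s, hs, hsμ⟩ : ∃ s : ℝ, 0 ≤ s ∧ μ = (s : ℂ) * s := by
    refine ⟨‖T w‖ / ‖w‖, by positivity, ?_⟩
    have h1 := hT w (T w)
    rw [hTT, inner_smul_right, inner_self_eq_norm_sq_to_K, inner_self_eq_norm_sq_to_K] at h1
    have hn' : ((‖w‖ : ℝ) : ℂ) ≠ 0 := Complex.ofReal_ne_zero.2 hn
    simp only [Complex.coe_algebraMap] at h1
    push_cast
    field_simp
    exact h1
  -- If the candidate vanishes then `T w = -s w`, and antilinearity flips the sign on `i w`.
  by_cases hu : T w + (s : ℂ) • w = 0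
  · refine ⟨Complex.I • w, W.smul_mem _ hw, smul_ne_zero Complex.I_ne_zero hw0, s, hs, ?_⟩
    rw [map_smulₛₗ, eq_neg_of_add_eq_zero_left hu, Complex.conj_I, smul_neg, neg_smul, neg_neg,
      smul_comm]
  · refine ⟨_, W.add_mem (hTW _ hw) (W.smul_mem _ hw), hu, s, hs, ?_⟩
    rw [map_add, map_smulₛₗ, hTT, hsμ, Complex.conj_ofReal, smul_add, smul_smul, add_comm]

/-- Deflation: by the symmetry of `T`, the orthogonal complement of the vectors already found is
invariant under `T`. -/
theorem exists_orthonormal_coneigenvectors [FiniteDimensional ℂ E] (T : E →ₗ⋆[ℂ] E)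
    (hT : ∀ v w, ⟪v, T w⟫_ℂ = ⟪w, T v⟫_ℂ) (k : ℕ) (hk : k ≤ Module.finrank ℂ E) :
    ∃ (v : Fin k → E) (a : Fin k → ℝ), Orthonormal ℂ v ∧ (∀ i, 0 ≤ a i) ∧
      ∀ i, T (v i) = (a i : ℂ) • v i := by
  induction k with
  | zero => exact ⟨Fin.elim0, Fin.elim0, ⟨fun i => i.elim0, fun i => i.elim0⟩, fun i => i.elim0,
      fun i => i.elim0⟩
  | succ k ih =>
    obtain ⟨v, a, hv, ha, hTv⟩ := ih (Nat.le_of_succ_le hk)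
    have hW : (Submodule.span ℂ (Set.range v))ᗮ ≠ ⊥ := by
      intro h
      rw [Submodule.orthogonal_eq_bot_iff] at h
      have h2 := finrank_range_le_card (R := ℂ) v
      rw [Set.finrank, h, finrank_top, Fintype.card_fin] at h2
      omega
    have hmem : ∀ w, w ∈ (Submodule.span ℂ (Set.range v))ᗮ ↔ ∀ i, ⟪v i, w⟫_ℂ = 0 := by
      intro w
      rw [Submodule.mem_orthogonal]
      refine ⟨fun h i => h _ (Submodule.subset_span ⟨i, rfl⟩), fun h u hu => ?_⟩
      induction hu using Submodule.span_induction with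
      | mem x hx => obtain ⟨i, rfl⟩ := hx; exact h i
      | zero => simp
      | add x y _ _ hx hy => rw [inner_add_left, hx, hy, add_zero]
      | smul c x _ hx => rw [inner_smul_left, hx, mul_zero]
    obtain ⟨u, huW, hu1, s, hs, hTu⟩ := exists_coneigenvector_mem T hT _ hW (fun w hw => by
      rw [hmem] at hw ⊢
      intro i
      rw [hT, hTv, inner_smul_right, ← inner_conj_symm, hw i, map_zero, mul_zero])
    rw [hmem] at huW
    refine ⟨Fin.cons u v, Fin.cons s a, ?_, ?_, ?_⟩
    · rw [orthonormal_iff_ite] at hv ⊢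
      intro i j
      refine Fin.cases ?_ (fun i => ?_) i <;> refine Fin.cases ?_ (fun j => ?_) j
      · simp [hu1]
      · simp only [Fin.cons_zero, Fin.cons_succ]
        rw [← inner_conj_symm, huW j, map_zero, if_neg (Fin.succ_ne_zero j).symm]
      · simp [huW i]
      · simpa using hv i j
    · intro i
      refine Fin.cases ?_ (fun i => ?_) i
      exacts [hs, ha i]
    · intro i
      refine Fin.cases ?_ (fun i => ?_) i
      exacts [hTu, hTv i]

variable {ι : Type} [Fintype ι] [DecidableEq ι]

/-- Takagi factorization of a complex symmetric matrix. -/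
theorem exists_takagiBy {A : Matrix ι ι ℂ} (hA : A.IsSymm) : ∃ U a, TakagiBy A U a := by
  -- `T v = A v̄`; the symmetry of `A` is exactly the symmetry required of `T`, and the
  -- coneigenvectors are the columns of `U`.
  let T : EuclideanSpace ℂ ι →ₗ⋆[ℂ] EuclideanSpace ℂ ι :=
    { toFun := fun v => WithLp.toLp 2 (A *ᵥ star v.ofLp)
      map_add' := fun v w => by simp [mulVec_add]
      map_smul' := fun c v => by simp [mulVec_smul] }
  have hT : ∀ v w, ⟪v, T w⟫_ℂ = ⟪w, T v⟫_ℂ := fun v w => by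
    simp only [T, EuclideanSpace.inner_eq_star_dotProduct, LinearMap.coe_mk, AddHom.coe_mk]
    rw [dotProduct_comm, dotProduct_mulVec, ← mulVec_transpose, hA.eq]
  obtain ⟨v, a, hv, ha, hTv⟩ := exists_orthonormal_coneigenvectors T hT (Fintype.card ι)
    (by simp)
  let e := Fintype.equivFin ι
  let U : Matrix ι ι ℂ := Matrix.of fun i j => v (e j) i
  have hU : Uᴴ * U = 1 := by
    ext i j
    have := orthonormal_iff_ite.1 hv (e i) (e j)
    rw [EuclideanSpace.inner_eq_star_dotProduct] at this
    simp only [EmbeddingLike.apply_eq_iff_eq] at this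
    rw [one_apply, ← this, dotProduct_comm]
    simp [mul_apply, U, dotProduct]
  have hU' : U * Uᴴ = 1 := mul_eq_one_comm.1 hU
  refine ⟨U, a ∘ e, hU', hU, fun i => ha _, ?_⟩
  have hAU : A * Uᴴᵀ = U * diagonal (fun i => ((a ∘ e) i : ℂ)) := by
    ext i j
    have := congrArg (fun w : EuclideanSpace ℂ ι => w i) (hTv (e j))
    simp only [T, LinearMap.coe_mk, AddHom.coe_mk] at this
    simp only [mul_diagonal, U, of_apply, Function.comp_apply]
    rw [mul_comm]
    simpa [mul_apply, mulVec, dotProduct] using this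
  rw [← hAU, Matrix.mul_assoc, conjTranspose_transpose_mul_transpose hU', Matrix.mul_one]

/-- Takagi factorization with sorted singular values. -/
theorem exists_takagiBy_singularValue {n : ℕ} {A : Matrix (Fin n) (Fin n) ℂ} (hA : A.IsSymm) :
    ∃ U, TakagiBy A U (fun i => singularValue A (i : ℕ)) := by
  obtain ⟨U, a, h⟩ := exists_takagiBy hA
  obtain ⟨e, he⟩ := exists_equiv_singularValue h.2.2.1 h.diagonalizedBy
  let e' : Fin n ≃ Fin n := (finCongr (Fintype.card_fin n).symm).trans e
  have he' : (fun i : Fin n => singularValue A (i : ℕ)) = a ∘ e' :=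
    funext fun i => he (Fin.cast (Fintype.card_fin n).symm i)
  refine ⟨U.submatrix id e', ?_, ?_, ?_, ?_⟩
  · rw [conjTranspose_submatrix, submatrix_mul_equiv, h.1, submatrix_id_id]
  · rw [conjTranspose_submatrix, ← submatrix_mul _ _ _ _ _ Function.bijective_id, h.2.1,
      submatrix_one_equiv]
  · exact fun i => LinearMap.singularValues_nonneg _ _
  · have hd : diagonal (fun i : Fin n => ((singularValue A (i : ℕ) : ℝ) : ℂ)) =
        (diagonal (fun i => (a i : ℂ))).submatrix e' e' := by
      rw [submatrix_diagonal_equiv]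
      congr
      ext i
      exact congrArg Complex.ofReal (congrFun he' i)
    rw [hd, transpose_submatrix, submatrix_mul_equiv, submatrix_mul_equiv, submatrix_id_id]
    exact h.2.2.2

end Takagi

/-! ### Direct sums on phase space. -/

section DirectSum

variable {ι κ : Type}

theorem directSum_transpose (σ : PhaseMatrix ι) (τ : PhaseMatrix κ) :
    (directSum σ τ)ᵀ = directSum σᵀ τᵀ := by
  simp [directSum, transpose_submatrix, fromBlocks_transpose]

theorem directSum_mul [Fintype ι] [Fintype κ] (σ σ' : PhaseMatrix ι) (τ τ' : PhaseMatrix κ) :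
    directSum σ τ * directSum σ' τ' = directSum (σ * σ') (τ * τ') := by
  simp [directSum, submatrix_mul_equiv, fromBlocks_multiply]

/-- A change of quadratures on the bath alone is invisible after the bath is discarded. -/
theorem reduceFst_directSum_one_mul_mul [Fintype ι] [Fintype κ] [DecidableEq ι] (S : PhaseMatrix κ)
    (X : PhaseMatrix (ι ⊕ κ)) :
    reduceFst (directSum 1 S * X * (directSum 1 S)ᵀ) = reduceFst X := by
  have h : ∀ (a : ι ⊕ ι) (Y : PhaseMatrix (ι ⊕ κ)) c,
      (directSum 1 S * Y : PhaseMatrix (ι ⊕ κ)) (Sum.map Sum.inl Sum.inl a) c =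
        Y (Sum.map Sum.inl Sum.inl a) c := by
    rintro (a | a) Y c <;>
      simp [mul_apply, directSum, one_apply]
  ext a b
  simp only [reduceFst, submatrix_apply]
  rw [Matrix.mul_assoc, h, ← transpose_apply (X * _), transpose_mul, transpose_transpose, h,
    transpose_apply]

variable [DecidableEq ι] [DecidableEq κ]

theorem directSum_modeDiagonal (d : ι → ℝ) (d' : κ → ℝ) :
    directSum (modeDiagonal d) (modeDiagonal d') = modeDiagonal (Sum.elim d d') := by
  ext ((i | i) | (i | i)) ((j | j) | (j | j)) <;>
    simp [directSum, modeDiagonal, diagonal_apply]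

theorem modeDiagonal_const (c : ℝ) : modeDiagonal (fun _ : ι => c) = c • (1 : PhaseMatrix ι) := by
  ext (i | i) (j | j) <;> simp [modeDiagonal, diagonal_apply, one_apply]

theorem directSum_one_one : directSum (1 : PhaseMatrix ι) (1 : PhaseMatrix κ) = 1 := by
  ext ((i | i) | (i | i)) ((j | j) | (j | j)) <;> simp [directSum, one_apply]

theorem directSum_J : directSum (J ι ℝ) (J κ ℝ) = J (ι ⊕ κ) ℝ := by
  ext ((i | i) | (i | i)) ((j | j) | (j | j)) <;> simp [directSum, J, one_apply]

theorem directSum_mem_symplecticGroup [Fintype ι] [Fintype κ] {S : PhaseMatrix ι}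
    {S' : PhaseMatrix κ} (hS : S ∈ symplecticGroup ι ℝ) (hS' : S' ∈ symplecticGroup κ ℝ) :
    directSum S S' ∈ symplecticGroup (ι ⊕ κ) ℝ := by
  rw [SymplecticGroup.mem_iff] at *
  rw [directSum_transpose, ← directSum_J, directSum_mul, directSum_mul, hS, hS']

end DirectSum

/-! ### From real phase space to annihilation operators. -/

section ComplexForm

variable {ι : Type} [DecidableEq ι]

/-- The row matrix `[1, i]`, which maps the quadratures to `√2` times the annihilation
operators. -/
def modeRow (ι : Type) [DecidableEq ι] : Matrix ι (ι ⊕ ι) ℂ :=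
  fromCols 1 (Complex.I • 1)

/-- The symmetrized second moments `½ ⟨a_j† a_i + a_i a_j†⟩`. -/
noncomputable def hMatrix [Fintype ι] (σ : PhaseMatrix ι) : Matrix ι ι ℂ :=
  (1 / 2 : ℂ) • (modeRow ι * σ.map Complex.ofReal * (modeRow ι)ᴴ)

variable [Fintype ι]

theorem modeRow_mul_apply {κ : Type} (X : Matrix (ι ⊕ ι) κ ℂ) (i : ι) (j : κ) :
    (modeRow ι * X) i j = X (Sum.inl i) j + Complex.I * X (Sum.inr i) j := by
  simp [modeRow, mul_apply, Fintype.sum_sum_type, one_apply]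

theorem mul_modeRow_conjTranspose_apply {κ : Type} (X : Matrix κ (ι ⊕ ι) ℂ) (i : κ) (j : ι) :
    (X * (modeRow ι)ᴴ) i j = X i (Sum.inl j) - Complex.I * X i (Sum.inr j) := by
  simp [modeRow, mul_apply, Fintype.sum_sum_type, one_apply, apply_ite (starRingEnd ℂ)]
  ring

theorem mul_modeRow_transpose_apply {κ : Type} (X : Matrix κ (ι ⊕ ι) ℂ) (i : κ) (j : ι) :
    (X * (modeRow ι)ᵀ) i j = X i (Sum.inl j) + Complex.I * X i (Sum.inr j) := by
  simp [modeRow, mul_apply, Fintype.sum_sum_type, one_apply]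
  ring

theorem hMatrix_apply (σ : PhaseMatrix ι) (i j : ι) :
    hMatrix σ i j =
      ((σ (Sum.inl i) (Sum.inl j) + σ (Sum.inr i) (Sum.inr j) : ℝ) : ℂ) / 2
      + Complex.I * ((σ (Sum.inr i) (Sum.inl j) - σ (Sum.inl i) (Sum.inr j) : ℝ) : ℂ) / 2 := by
  simp only [hMatrix, Matrix.smul_apply, mul_modeRow_conjTranspose_apply, modeRow_mul_apply,
    map_apply, smul_eq_mul]
  push_cast
  linear_combination (-(1 / 2) * (σ (Sum.inr i) (Sum.inr j) : ℂ)) * Complex.I_mul_I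

theorem aMatrix_eq (σ : PhaseMatrix ι) :
    aMatrix σ = (1 / 2 : ℂ) • (modeRow ι * σ.map Complex.ofReal * (modeRow ι)ᵀ) := by
  ext i j
  simp only [aMatrix, of_apply, Matrix.smul_apply, mul_modeRow_transpose_apply, modeRow_mul_apply,
    map_apply, smul_eq_mul]
  push_cast
  linear_combination (-(1 / 2) * (σ (Sum.inr i) (Sum.inr j) : ℂ)) * Complex.I_mul_I

theorem mMatrix_eq (β ω : ℝ) (σ : PhaseMatrix ι) :
    mMatrix β ω σ = hMatrix σ - (thermalVariance β ω : ℂ) • 1 := by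
  ext i j
  simp [mMatrix, hMatrix_apply, one_apply]

theorem modeRow_mul_conjTranspose : modeRow ι * (modeRow ι)ᴴ = (2 : ℂ) • 1 := by
  ext i j
  rw [mul_modeRow_conjTranspose_apply]
  by_cases h : i = j
  · simp [modeRow, h]; norm_num
  · simp [modeRow, h]

/-- `J` is minus the symplectic form, so this is `1 + i Ω`. It commutes with every matrix that
commutes with `J`, and its factored form makes it positive semidefinite. -/
theorem conjTranspose_mul_modeRow :
    (modeRow ι)ᴴ * modeRow ι = 1 - Complex.I • (J ι ℝ).map Complex.ofReal := by
  ext (i | i) (j | j) <;> rcases eq_or_ne i j with rfl | h <;>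
    simp_all [modeRow, mul_apply, J, one_apply, eq_comm]

/-- Commuting with `J` means acting complex linearly on `x + i p`. The formula for second moments
then also reads off the complex matrix of the transformation. -/
theorem modeRow_mul_map {X : PhaseMatrix ι} (hX : X * J ι ℝ = J ι ℝ * X) :
    modeRow ι * X.map Complex.ofReal = hMatrix X * modeRow ι := by
  have hX' : X.map Complex.ofReal * (J ι ℝ).map Complex.ofReal =
      (J ι ℝ).map Complex.ofReal * X.map Complex.ofReal := by
    have := congrArg (fun Y : PhaseMatrix ι => Y.map Complex.ofRealHom) hX
    simp only [Matrix.map_mul] at this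
    exact this
  calc modeRow ι * X.map Complex.ofReal
      = (1 / 2 : ℂ) • (modeRow ι * (modeRow ι)ᴴ * (modeRow ι * X.map Complex.ofReal)) := by
        rw [modeRow_mul_conjTranspose, Matrix.smul_mul, Matrix.one_mul, smul_smul]
        norm_num
    _ = (1 / 2 : ℂ) • (modeRow ι * ((modeRow ι)ᴴ * modeRow ι * X.map Complex.ofReal)) := by
        simp only [Matrix.mul_assoc]
    _ = (1 / 2 : ℂ) • (modeRow ι * (X.map Complex.ofReal * ((modeRow ι)ᴴ * modeRow ι))) := by
        rw [conjTranspose_mul_modeRow, Matrix.sub_mul, Matrix.one_mul,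
          Matrix.mul_sub (X.map Complex.ofReal), Matrix.mul_one, Matrix.smul_mul, Matrix.mul_smul,
          hX']
    _ = hMatrix X * modeRow ι := by
        simp only [hMatrix, Matrix.smul_mul, Matrix.mul_assoc]

theorem map_ofReal_mul_mul_transpose {ι : Type} [Fintype ι] (X σ : PhaseMatrix ι) :
    (X * σ * Xᵀ).map Complex.ofReal =
      X.map Complex.ofReal * σ.map Complex.ofReal * (X.map Complex.ofReal)ᵀ := by
  have h := Matrix.map_mul (L := X * σ) (M := Xᵀ) (f := Complex.ofRealHom)
  exact h.trans (congrArg (· * _) (Matrix.map_mul (L := X) (M := σ) (f := Complex.ofRealHom)))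

theorem map_ofReal_conjTranspose {ι : Type} (X : PhaseMatrix ι) :
    (X.map Complex.ofReal)ᴴ = (X.map Complex.ofReal)ᵀ := by
  ext i j; simp

theorem hMatrix_mul_mul_transpose {X : PhaseMatrix ι} (hX : X * J ι ℝ = J ι ℝ * X)
    (σ : PhaseMatrix ι) : hMatrix (X * σ * Xᵀ) = hMatrix X * hMatrix σ * (hMatrix X)ᴴ := by
  have h2 := congrArg conjTranspose (modeRow_mul_map hX)
  rw [conjTranspose_mul, conjTranspose_mul, map_ofReal_conjTranspose] at h2
  calc hMatrix (X * σ * Xᵀ)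
      = (1 / 2 : ℂ) • ((modeRow ι * X.map Complex.ofReal) * σ.map Complex.ofReal *
          ((X.map Complex.ofReal)ᵀ * (modeRow ι)ᴴ)) := by
        rw [hMatrix, map_ofReal_mul_mul_transpose]
        simp only [Matrix.mul_assoc]
    _ = _ := by
        rw [h2, modeRow_mul_map hX, hMatrix.eq_def (σ := σ)]
        simp only [Matrix.mul_assoc, Matrix.smul_mul, Matrix.mul_smul]

theorem aMatrix_mul_mul_transpose {X : PhaseMatrix ι} (hX : X * J ι ℝ = J ι ℝ * X)
    (σ : PhaseMatrix ι) : aMatrix (X * σ * Xᵀ) = hMatrix X * aMatrix σ * (hMatrix X)ᵀ := by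
  have h2 := congrArg transpose (modeRow_mul_map hX)
  rw [transpose_mul, transpose_mul] at h2
  calc aMatrix (X * σ * Xᵀ)
      = (1 / 2 : ℂ) • ((modeRow ι * X.map Complex.ofReal) * σ.map Complex.ofReal *
          ((X.map Complex.ofReal)ᵀ * (modeRow ι)ᵀ)) := by
        rw [aMatrix_eq, map_ofReal_mul_mul_transpose]
        simp only [Matrix.mul_assoc]
    _ = _ := by
        rw [h2, modeRow_mul_map hX, aMatrix_eq]
        simp only [Matrix.mul_assoc, Matrix.smul_mul, Matrix.mul_smul]

theorem hMatrix_one : hMatrix (1 : PhaseMatrix ι) = 1 := by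
  ext i j
  rcases eq_or_ne i j with rfl | h <;> simp [hMatrix_apply, *]

/-- The real form of a complex matrix on phase space. -/
def realForm {ι : Type} (U : Matrix ι ι ℂ) : PhaseMatrix ι :=
  fromBlocks (U.map Complex.re) (-U.map Complex.im) (U.map Complex.im) (U.map Complex.re)

theorem realForm_mul {ι : Type} [Fintype ι] (U V : Matrix ι ι ℂ) :
    realForm (U * V) = realForm U * realForm V := by
  rw [realForm, realForm, realForm, fromBlocks_multiply]
  congr 1 <;> ext i j <;>
    simp [mul_apply, Complex.mul_re, Complex.mul_im, Finset.sum_add_distrib, sub_eq_add_neg,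
      add_comm]

theorem realForm_conjTranspose {ι : Type} (U : Matrix ι ι ℂ) : realForm Uᴴ = (realForm U)ᵀ := by
  rw [realForm, realForm, fromBlocks_transpose]
  congr 1
  all_goals
    ext i j
    simp

theorem realForm_one {ι : Type} [DecidableEq ι] : realForm (1 : Matrix ι ι ℂ) = 1 := by
  rw [realForm, ← fromBlocks_one]
  congr 1 <;> ext i j <;> rcases eq_or_ne i j with rfl | h <;> simp [*]

theorem realForm_mul_J (U : Matrix ι ι ℂ) : realForm U * J ι ℝ = J ι ℝ * realForm U := by
  simp [realForm, J, fromBlocks_multiply]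

theorem hMatrix_realForm (U : Matrix ι ι ℂ) : hMatrix (realForm U) = U := by
  ext i j
  rw [hMatrix_apply]
  apply Complex.ext <;> simp [realForm]

end ComplexForm

/-! ### Gaussian thermal operations as contractions. -/

section Energy

variable {ι : Type} [Fintype ι] [DecidableEq ι]

/-- A symplectic matrix that preserves a Hamiltonian in normal form is orthogonal, commutes with
the symplectic form, and couples only modes of equal frequency. -/
theorem symplectic_preserving_modeDiagonal {u : ι → ℝ} (hu : ∀ i, 0 < u i) {T : PhaseMatrix ι}
    (hT : T ∈ symplecticGroup ι ℝ) (hD : Tᵀ * modeDiagonal u * T = modeDiagonal u) :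
    T * Tᵀ = 1 ∧ T * J ι ℝ = J ι ℝ * T ∧
      ∀ a b, T a b ≠ 0 → Sum.elim u u a = Sum.elim u u b := by
  rw [SymplecticGroup.mem_iff] at hT
  have hu' : ∀ a, 0 < Sum.elim u u a := by rintro (a | a) <;> exact hu a
  have hJD : J ι ℝ * modeDiagonal u = modeDiagonal u * J ι ℝ := by
    ext (i | i) (j | j) <;> by_cases h : i = j <;> simp [J, modeDiagonal, h]
  -- `T` commutes with the generator `J D` of the free evolution. Squaring gives commutation with
  -- `D²`, and positivity of the frequencies then gives it for `D`, hence for `J`.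
  have h1 : T * (J ι ℝ * modeDiagonal u) = J ι ℝ * modeDiagonal u * T := by
    calc T * (J ι ℝ * modeDiagonal u) = T * (J ι ℝ * (Tᵀ * modeDiagonal u * T)) := by rw [hD]
      _ = T * J ι ℝ * Tᵀ * modeDiagonal u * T := by simp only [Matrix.mul_assoc]
      _ = _ := by rw [hT]
  have h2 : (J ι ℝ * modeDiagonal u) * (J ι ℝ * modeDiagonal u) =
      -(modeDiagonal u * modeDiagonal u) := by
    calc (J ι ℝ * modeDiagonal u) * (J ι ℝ * modeDiagonal u)
        = J ι ℝ * (modeDiagonal u * J ι ℝ) * modeDiagonal u := by simp only [Matrix.mul_assoc]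
      _ = J ι ℝ * J ι ℝ * (modeDiagonal u * modeDiagonal u) := by
          rw [← hJD]; simp only [Matrix.mul_assoc]
      _ = _ := by rw [J_squared]; simp
  have h3 : T * (modeDiagonal u * modeDiagonal u) = (modeDiagonal u * modeDiagonal u) * T := by
    have : T * -(modeDiagonal u * modeDiagonal u) = -(modeDiagonal u * modeDiagonal u) * T := by
      rw [← h2, ← Matrix.mul_assoc, h1, Matrix.mul_assoc, h1, ← Matrix.mul_assoc]
    rwa [Matrix.mul_neg, Matrix.neg_mul, neg_inj] at this
  have h4 : ∀ a b, T a b ≠ 0 → Sum.elim u u a = Sum.elim u u b := fun a b hab => by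
    have := congrFun (congrFun h3 a) b
    rw [modeDiagonal, diagonal_mul_diagonal, mul_diagonal, diagonal_mul, mul_comm,
      mul_left_inj' hab] at this
    exact ((mul_self_inj (hu' b).le (hu' a).le).1 this).symm
  have h5 : T * modeDiagonal u = modeDiagonal u * T := by
    ext a b
    rw [modeDiagonal, mul_diagonal, diagonal_mul, mul_comm]
    by_cases hab : T a b = 0
    · simp [hab]
    · rw [h4 a b hab]
  have hinv : modeDiagonal u * diagonal (fun a => (Sum.elim u u a)⁻¹) = 1 := by
    rw [modeDiagonal, diagonal_mul_diagonal, ← diagonal_one]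
    congr
    ext a
    exact mul_inv_cancel₀ (hu' a).ne'
  refine ⟨?_, ?_, h4⟩
  · apply mul_eq_one_comm.1
    rw [Matrix.mul_assoc, ← h5, ← Matrix.mul_assoc] at hD
    rw [← Matrix.mul_one (Tᵀ * T), ← hinv, ← Matrix.mul_assoc, hD]
  · have h6 : T * J ι ℝ * modeDiagonal u = J ι ℝ * T * modeDiagonal u := by
      rw [Matrix.mul_assoc, h1, Matrix.mul_assoc, Matrix.mul_assoc, h5]
    rw [← Matrix.mul_one (T * J ι ℝ), ← hinv, ← Matrix.mul_assoc, h6, Matrix.mul_assoc, hinv,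
      Matrix.mul_one]

end Energy

section GTO

variable {ι κ : Type} [Fintype ι] [DecidableEq ι] [Fintype κ] [DecidableEq κ]

theorem hMatrix_reduceFst (σ : PhaseMatrix (ι ⊕ κ)) :
    hMatrix (reduceFst σ) = (hMatrix σ).toBlocks₁₁ := by
  ext i j
  simp [toBlocks₁₁, hMatrix_apply, reduceFst]

theorem aMatrix_reduceFst {ι κ : Type} (σ : PhaseMatrix (ι ⊕ κ)) :
    aMatrix (reduceFst σ) = (aMatrix σ).toBlocks₁₁ := by
  ext i j
  simp [toBlocks₁₁, aMatrix, reduceFst]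

theorem hMatrix_directSum (σ : PhaseMatrix ι) (τ : PhaseMatrix κ) :
    hMatrix (directSum σ τ) = fromBlocks (hMatrix σ) 0 0 (hMatrix τ) := by
  ext (i | i) (j | j) <;> simp [hMatrix_apply, directSum]

theorem aMatrix_directSum {ι κ : Type} (σ : PhaseMatrix ι) (τ : PhaseMatrix κ) :
    aMatrix (directSum σ τ) = fromBlocks (aMatrix σ) 0 0 (aMatrix τ) := by
  ext (i | i) (j | j) <;> simp [aMatrix, directSum]

theorem hMatrix_modeDiagonal (d : ι → ℝ) :
    hMatrix (modeDiagonal d) = diagonal (fun i => (d i : ℂ)) := by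
  ext i j
  by_cases h : i = j <;> simp [hMatrix_apply, modeDiagonal, h]

theorem aMatrix_modeDiagonal {ι : Type} [DecidableEq ι] (d : ι → ℝ) :
    aMatrix (modeDiagonal d) = 0 := by
  ext i j
  by_cases h : i = j <;> simp [aMatrix, modeDiagonal, diagonal_apply, h]

/-- The effect of a passive transformation with a thermal bath on the second moments. -/
theorem moments_reduceFst_passive {β ω : ℝ} {w : κ → ℝ} {T : PhaseMatrix (ι ⊕ κ)}
    (hTT : T * Tᵀ = 1) (hTJ : T * J (ι ⊕ κ) ℝ = J (ι ⊕ κ) ℝ * T)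
    (hTw : ∀ a b, T a b ≠ 0 → Sum.elim (Sum.elim (fun _ => ω) w) (Sum.elim (fun _ => ω) w) a =
      Sum.elim (Sum.elim (fun _ => ω) w) (Sum.elim (fun _ => ω) w) b) (σ : PhaseMatrix ι) :
    (1 - (hMatrix T).toBlocks₁₁ * (hMatrix T).toBlocks₁₁ᴴ).PosSemidef ∧
    mMatrix β ω (reduceFst (T * directSum σ (modeDiagonal fun l => thermalVariance β (w l)) * Tᵀ))
      = (hMatrix T).toBlocks₁₁ * mMatrix β ω σ * (hMatrix T).toBlocks₁₁ᴴ ∧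
    aMatrix (reduceFst (T * directSum σ (modeDiagonal fun l => thermalVariance β (w l)) * Tᵀ))
      = (hMatrix T).toBlocks₁₁ * aMatrix σ * (hMatrix T).toBlocks₁₁ᵀ := by
  set u : ι ⊕ κ → ℝ := Sum.elim (fun _ => ω) w with hu
  set U := hMatrix T with hU
  have hUU : U * Uᴴ = 1 := by
    have := hMatrix_mul_mul_transpose hTJ 1
    rwa [Matrix.mul_one, hTT, hMatrix_one, Matrix.mul_one, eq_comm] at this
  set D : Matrix (ι ⊕ κ) (ι ⊕ κ) ℂ := diagonal (fun i => (thermalVariance β (u i) : ℂ)) with hDdef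
  -- Thermal variances depend only on the frequency, and `U` couples only equal frequencies.
  have hUD : U * D = D * U := by
    ext i j
    rw [hDdef, mul_diagonal, diagonal_mul, mul_comm]
    by_cases h : u i = u j
    · rw [h]
    · have h0 : ∀ a b, Sum.elim u u a ≠ Sum.elim u u b → T a b = 0 := fun a b hab =>
        not_not.1 fun h => hab (hTw a b h)
      have : U i j = 0 := by
        rw [hU, hMatrix_apply, h0 (Sum.inl i) (Sum.inl j) h, h0 (Sum.inr i) (Sum.inr j) h,
          h0 (Sum.inr i) (Sum.inl j) h, h0 (Sum.inl i) (Sum.inr j) h]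
        simp
      simp [this]
  have hblock : U = fromBlocks U.toBlocks₁₁ U.toBlocks₁₂ U.toBlocks₂₁ U.toBlocks₂₂ :=
    (fromBlocks_toBlocks U).symm
  have hsandwich : ∀ X : Matrix ι ι ℂ, (U * fromBlocks X 0 0 0 * Uᴴ).toBlocks₁₁ =
      U.toBlocks₁₁ * X * U.toBlocks₁₁ᴴ := fun X => by
    conv_lhs => rw [hblock, fromBlocks_conjTranspose, fromBlocks_multiply, fromBlocks_multiply,
      toBlocks_fromBlocks₁₁]
    simp
  have hsandwich' : ∀ X : Matrix ι ι ℂ, (U * fromBlocks X 0 0 0 * Uᵀ).toBlocks₁₁ =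
      U.toBlocks₁₁ * X * U.toBlocks₁₁ᵀ := fun X => by
    conv_lhs => rw [hblock, fromBlocks_transpose, fromBlocks_multiply, fromBlocks_multiply,
      toBlocks_fromBlocks₁₁]
    simp
  refine ⟨?_, ?_, ?_⟩
  · have h : (1 : Matrix ι ι ℂ) = U.toBlocks₁₁ * U.toBlocks₁₁ᴴ + U.toBlocks₁₂ * U.toBlocks₁₂ᴴ := by
      have := congrArg toBlocks₁₁ hUU
      conv_lhs at this => rw [hblock, fromBlocks_conjTranspose, fromBlocks_multiply,
        toBlocks_fromBlocks₁₁]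
      rw [this]
      ext i j
      simp [toBlocks₁₁, one_apply]
    rw [sub_eq_of_eq_add' h]
    exact posSemidef_self_mul_conjTranspose _
  -- The second moments are `(M ⊕ 0) + D` with `D` invariant under `U`. Subtracting `ν` in `M`
  -- removes the thermal contribution and leaves a homogeneous law.
  · have hsplit : hMatrix (directSum σ (modeDiagonal fun l => thermalVariance β (w l))) =
        fromBlocks (mMatrix β ω σ) 0 0 0 + D := by
      rw [hMatrix_directSum, hMatrix_modeDiagonal, mMatrix_eq]
      ext (i | i) (j | j) <;> simp [hDdef, hu, diagonal_apply, one_apply]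
    rw [mMatrix_eq, hMatrix_reduceFst, hMatrix_mul_mul_transpose hTJ, hsplit, ← hU, Matrix.mul_add,
      Matrix.add_mul, hUD, Matrix.mul_assoc D, hUU, Matrix.mul_one, ← hsandwich]
    ext i j
    simp [toBlocks₁₁, hDdef, hu, diagonal_apply, one_apply]
  · rw [aMatrix_reduceFst, aMatrix_mul_mul_transpose hTJ, aMatrix_directSum, aMatrix_modeDiagonal,
      ← hU, hsandwich']

/-- A Gaussian thermal operation acts on the matrices `M` and `A` by a contraction. -/
theorem GTO.exists_contraction {β ω : ℝ} (hω : 0 < ω) {σ σ' : PhaseMatrix ι}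
    (h : GTO β ω σ σ') : ∃ K : Matrix ι ι ℂ, (1 - K * Kᴴ).PosSemidef ∧
      mMatrix β ω σ' = K * mMatrix β ω σ * Kᴴ ∧ aMatrix σ' = K * aMatrix σ * Kᵀ := by
  obtain ⟨k, H, τ, ⟨S, hS, w, hw, rfl, hτ⟩, T, hT, hTH, rfl⟩ := h
  let S' : symplecticGroup (Fin k) ℝ := ⟨S, hS⟩
  have hR : ((S'⁻¹ : symplecticGroup (Fin k) ℝ) : PhaseMatrix (Fin k)) ∈
    symplecticGroup (Fin k) ℝ := (S'⁻¹).2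
  have hRS : ((S'⁻¹ : symplecticGroup (Fin k) ℝ) : PhaseMatrix (Fin k)) * S = 1 :=
    congrArg Subtype.val (inv_mul_cancel S')
  set R := ((S'⁻¹ : symplecticGroup (Fin k) ℝ) : PhaseMatrix (Fin k))
  have hSR : S * R = 1 := mul_eq_one_comm.1 hRS
  set u : ι ⊕ Fin k → ℝ := Sum.elim (fun _ => ω) w with hu
  -- `B` passes to the normal modes of the bath and `C` is its inverse; `B T C` is the interaction
  -- in these modes.
  set B : PhaseMatrix (ι ⊕ Fin k) := directSum 1 S with hB
  set C : PhaseMatrix (ι ⊕ Fin k) := directSum 1 R with hC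
  have hBC : B * C = 1 := by rw [hB, hC, directSum_mul, hSR, Matrix.one_mul, directSum_one_one]
  have hCB : C * B = 1 := mul_eq_one_comm.1 hBC
  have hHB : directSum (ω • (1 : PhaseMatrix ι)) (Sᵀ * modeDiagonal w * S) =
      Bᵀ * modeDiagonal u * B := by
    rw [hB, hu, directSum_transpose, ← directSum_modeDiagonal, directSum_mul, directSum_mul,
      modeDiagonal_const]
    simp
  rw [hHB] at hTH
  have hone : (1 : PhaseMatrix ι) ∈ symplecticGroup ι ℝ := one_mem _
  have hT' : B * T * C ∈ symplecticGroup (ι ⊕ Fin k) ℝ :=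
    mul_mem (mul_mem (directSum_mem_symplecticGroup hone hS) hT)
      (directSum_mem_symplecticGroup hone hR)
  have hD : (B * T * C)ᵀ * modeDiagonal u * (B * T * C) = modeDiagonal u := by
    calc (B * T * C)ᵀ * modeDiagonal u * (B * T * C)
        = Cᵀ * (Tᵀ * (Bᵀ * modeDiagonal u * B) * T) * C := by
          simp only [transpose_mul, Matrix.mul_assoc]
      _ = (B * C)ᵀ * modeDiagonal u * (B * C) := by
          rw [hTH]; simp only [transpose_mul, Matrix.mul_assoc]
      _ = _ := by rw [hBC]; simp
  have hu0 : ∀ i, 0 < u i := by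
    rintro (i | i)
    exacts [hω, hw i]
  obtain ⟨h1, h2, h3⟩ := symplectic_preserving_modeDiagonal hu0 hT' hD
  obtain ⟨h4, h5, h6⟩ := moments_reduceFst_passive (β := β) h1 h2 h3 σ
  have hred : reduceFst (T * directSum σ τ * Tᵀ) = reduceFst (B * T * C *
      directSum σ (modeDiagonal fun l => thermalVariance β (w l)) * (B * T * C)ᵀ) := by
    have h7 : directSum σ (modeDiagonal fun l => thermalVariance β (w l)) =
        B * directSum σ τ * Bᵀ := by
      rw [← hτ, hB, directSum_transpose, directSum_mul, directSum_mul]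
      simp
    rw [h7, ← reduceFst_directSum_one_mul_mul S, ← hB]
    congr 1
    calc B * (T * directSum σ τ * Tᵀ) * Bᵀ
        = B * T * 1 * directSum σ τ * 1ᵀ * Tᵀ * Bᵀ := by simp [Matrix.mul_assoc]
      _ = _ := by rw [← hCB]; simp only [transpose_mul, Matrix.mul_assoc]
  rw [hred]
  exact ⟨_, h4, h5, h6⟩

/-- Every contraction, given by its singular value decomposition, is realized by a Gaussian
thermal operation. -/
theorem exists_GTO_of_contraction {β ω : ℝ} (hω : 0 < ω) (σ : PhaseMatrix ι)
    {V W : Matrix ι ι ℂ} {c : ι → ℝ} (hV : V * Vᴴ = 1) (hW : W * Wᴴ = 1)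
    (hc : ∀ i, c i ^ 2 ≤ 1) :
    ∃ σ', GTO β ω σ σ' ∧
      mMatrix β ω σ' = (V * diagonal (fun i => (c i : ℂ)) * W) * mMatrix β ω σ *
        (V * diagonal (fun i => (c i : ℂ)) * W)ᴴ ∧
      aMatrix σ' = (V * diagonal (fun i => (c i : ℂ)) * W) * aMatrix σ *
        (V * diagonal (fun i => (c i : ℂ)) * W)ᵀ := by
  let e := Fintype.equivFin ι
  set C := diagonal (fun i => (c i : ℂ)) with hC
  set S := diagonal (fun i => ((√(1 - c i ^ 2) : ℝ) : ℂ)) with hS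
  have hCH : Cᴴ = C := diagonal_ofReal_conjTranspose c
  have hSH : Sᴴ = S := diagonal_ofReal_conjTranspose _
  have hCS : C * C + S * S = 1 := by
    rw [hC, hS, diagonal_mul_diagonal, diagonal_mul_diagonal, diagonal_add, ← diagonal_one]
    congr
    ext i
    rw [← Complex.ofReal_mul, ← Complex.ofReal_mul, ← Complex.ofReal_add,
      Real.mul_self_sqrt (sub_nonneg.2 (hc i)), ← sq, add_sub_cancel, Complex.ofReal_one]
  have hcomm : C * S = S * C := by
    rw [hC, hS, diagonal_mul_diagonal, diagonal_mul_diagonal]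
    congr
    ext i
    exact mul_comm _ _
  -- `U₂` couples each system mode to its own bath mode by a beam splitter with amplitude `c i`;
  -- `U₁` and `U₃` rotate only the system. All frequencies equal `ω`, so the product conserves
  -- energy.
  let U₁ : Matrix (ι ⊕ ι) (ι ⊕ ι) ℂ := fromBlocks V 0 0 1
  let U₂ : Matrix (ι ⊕ ι) (ι ⊕ ι) ℂ := fromBlocks C S (-S) C
  let U₃ : Matrix (ι ⊕ ι) (ι ⊕ ι) ℂ := fromBlocks W 0 0 1
  have h₁ : U₁ * U₁ᴴ = 1 := by
    simp [U₁, fromBlocks_conjTranspose, fromBlocks_multiply, hV]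
  have h₂ : U₂ * U₂ᴴ = 1 := by
    simp [U₂, fromBlocks_conjTranspose, fromBlocks_multiply, hCH, hSH, hCS, hcomm,
      add_comm (S * S)]
  have h₃ : U₃ * U₃ᴴ = 1 := by
    simp [U₃, fromBlocks_conjTranspose, fromBlocks_multiply, hW]
  have hU : (U₁ * U₂ * U₃) * (U₁ * U₂ * U₃)ᴴ = 1 := by
    calc (U₁ * U₂ * U₃) * (U₁ * U₂ * U₃)ᴴ = U₁ * (U₂ * (U₃ * U₃ᴴ) * U₂ᴴ) * U₁ᴴ := by
          simp only [conjTranspose_mul, Matrix.mul_assoc]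
      _ = 1 := by rw [h₃, Matrix.mul_one, h₂, Matrix.mul_one, h₁]
  let f := Equiv.sumCongr (Equiv.refl ι) e
  let U : Matrix (ι ⊕ Fin (Fintype.card ι)) (ι ⊕ Fin (Fintype.card ι)) ℂ :=
    (U₁ * U₂ * U₃).submatrix f.symm f.symm
  have hUU : U * Uᴴ = 1 := by
    simp only [U]
    rw [conjTranspose_submatrix, submatrix_mul_equiv, hU, submatrix_one_equiv]
  have hK : U.toBlocks₁₁ = V * C * W := by
    have : U.toBlocks₁₁ = (U₁ * U₂ * U₃).toBlocks₁₁ := by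
      ext i j
      simp [U, toBlocks₁₁, f]
    rw [this]
    simp [U₁, U₂, U₃, fromBlocks_multiply]
  have hTT : realForm U * (realForm U)ᵀ = 1 := by
    rw [← realForm_conjTranspose, ← realForm_mul, hUU, realForm_one]
  have hTT' : (realForm U)ᵀ * realForm U = 1 := mul_eq_one_comm.1 hTT
  have hconst : (Sum.elim (fun _ : ι => ω) fun _ : Fin (Fintype.card ι) => ω) = fun _ => ω := by
    ext (i | i) <;> rfl
  obtain ⟨-, h5, h6⟩ := moments_reduceFst_passive (β := β) (ω := ω)
    (w := fun _ : Fin (Fintype.card ι) => ω) hTT (realForm_mul_J U)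
    (by simp only [hconst]; rintro (a | a) (b | b) _ <;> rfl) σ
  rw [hMatrix_realForm, hK] at h5 h6
  refine ⟨_, ⟨Fintype.card ι, modeDiagonal fun _ => ω, _, ⟨1, one_mem _, fun _ => ω,
    fun _ => hω, by simp, by simp⟩, realForm U, ?_, ?_, rfl⟩, h5, h6⟩
  · rw [SymplecticGroup.mem_iff, realForm_mul_J, Matrix.mul_assoc, hTT, Matrix.mul_one]
  · rw [← modeDiagonal_const, directSum_modeDiagonal, hconst, modeDiagonal_const, mul_smul_comm,
      Matrix.mul_one, smul_mul_assoc, hTT']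

end GTO

/-! ### Lower bounds on the error. -/

theorem posSemidef_fromBlocks_diagonal {ι κ : Type} [Fintype ι] [DecidableEq ι] [Fintype κ]
    [DecidableEq κ] {P : Matrix ι ι ℂ} {Q : Matrix κ κ ℂ} (hP : P.PosSemidef)
    (hQ : Q.PosSemidef) : (fromBlocks P 0 0 Q).PosSemidef := by
  refine (hP.1.diagonalizedBy.fromBlocks hQ.1.diagonalizedBy).posSemidef ?_
  rintro (i | i)
  exacts [hP.eigenvalues_nonneg i, hQ.eigenvalues_nonneg i]

theorem fromBlocks_sub_fromBlocks {ι κ : Type} (A A' : Matrix ι ι ℂ) (B B' : Matrix ι κ ℂ)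
    (C C' : Matrix κ ι ℂ) (D D' : Matrix κ κ ℂ) :
    fromBlocks A B C D - fromBlocks A' B' C' D' =
      fromBlocks (A - A') (B - B') (C - C') (D - D') := by
  ext (i | i) (j | j) <;> rfl

theorem hermitianDilation_sub {ι : Type} (A B : Matrix ι ι ℂ) :
    hermitianDilation (A - B) = hermitianDilation A - hermitianDilation B := by
  rw [hermitianDilation, hermitianDilation, hermitianDilation, fromBlocks_sub_fromBlocks,
    conjTranspose_sub, sub_self]

/-- Turns `A ↦ K A Kᵀ` into a Hermitian congruence by the block matrix of `K` and its entrywise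
conjugate, to which `levelExcess_le` applies. -/
theorem hermitianDilation_mul_mul_transpose {ι : Type} [Fintype ι] (A K : Matrix ι ι ℂ) :
    hermitianDilation (K * A * Kᵀ) =
      fromBlocks K 0 0 Kᴴᵀ * hermitianDilation A * (fromBlocks K 0 0 Kᴴᵀ)ᴴ := by
  have hKt : Kᴴᵀᴴ = Kᵀ := by
    ext i j; simp
  have hKc : Kᵀᴴ = Kᴴᵀ := rfl
  rw [hermitianDilation, hermitianDilation, fromBlocks_conjTranspose, fromBlocks_multiply,
    fromBlocks_multiply, hKt, conjTranspose_mul, conjTranspose_mul, hKc]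
  simp [Matrix.mul_assoc]

section LowerBound

variable {ι κ : Type} [Fintype ι] [DecidableEq ι] [Fintype κ] [DecidableEq κ]

/-- The perturbation bound is used once for the matrices and once for their negatives; the traces of
the positive and negative parts of the error add up to its trace norm. -/
theorem sum_mu_le_traceNorm {M M' : Matrix ι ι ℂ} (hM : M.IsHermitian) (hM' : M'.IsHermitian)
    {C : Matrix κ κ ℂ} (hC : C.IsHermitian) {K : Matrix (ι ⊕ κ) (ι ⊕ κ) ℂ}
    (hK : (1 - K * Kᴴ).PosSemidef) :
    ∑ i, max (muPlus hM' i - muPlus hM i) 0 + ∑ i, max (muMinus hM' i - muMinus hM i) 0 ≤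
      traceNorm (fromBlocks M' 0 0 C - K * fromBlocks M 0 0 C * Kᴴ) := by
  have hX := hM'.diagonalizedBy.fromBlocks hC.diagonalizedBy
  have hY := hM.diagonalizedBy.fromBlocks hC.diagonalizedBy
  have hZh : (fromBlocks M' 0 0 C - K * fromBlocks M 0 0 C * Kᴴ).IsHermitian :=
    hX.isHermitian.sub (isHermitian_mul_mul_conjTranspose _ hY.isHermitian)
  have hZ := hZh.diagonalizedBy
  have h1 := levelExcess_le hX hY hZ hK (by abel)
  have h2 := levelExcess_le hX.neg hY.neg hZ.neg hK (by
    rw [Matrix.mul_neg, Matrix.neg_mul]; abel)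
  rw [hZ.traceNorm_eq]
  let e : Fin (Fintype.card ι) ≃ ι := Fintype.equivOfCardEq (Fintype.card_fin _)
  have h3 : levelExcess (Sum.elim hM'.eigenvalues hC.eigenvalues)
      (Sum.elim hM.eigenvalues hC.eigenvalues) =
      levelExcess hM'.eigenvalues₀ hM.eigenvalues₀ := by
    rw [levelExcess_sumElim]
    exact levelExcess_comp_equiv e.symm hM'.eigenvalues₀ hM.eigenvalues₀
  -- Negation reverses the order, so `Fin.rev` restores sorted lists.
  have h4 : levelExcess (-Sum.elim hM'.eigenvalues hC.eigenvalues)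
      (-Sum.elim hM.eigenvalues hC.eigenvalues) =
      levelExcess (fun i : Fin (Fintype.card ι) => -hM'.eigenvalues₀ i.rev)
        (fun i : Fin (Fintype.card ι) => -hM.eigenvalues₀ i.rev) := by
    rw [← Sum.elim_neg_neg, ← Sum.elim_neg_neg, levelExcess_sumElim,
      ← levelExcess_comp_equiv (e.symm.trans Fin.revPerm)
        (fun i : Fin (Fintype.card ι) => -hM'.eigenvalues₀ i.rev)]
    congr <;> ext i <;> simp [IsHermitian.eigenvalues, e]
  rw [h3] at h1
  rw [h4] at h2
  have h5 := sum_max_sub_le_levelExcess hM'.eigenvalues₀_antitone hM.eigenvalues₀_antitone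
  have hanti : ∀ {N : Matrix ι ι ℂ} (hN : N.IsHermitian),
      Antitone fun i : Fin (Fintype.card ι) => -hN.eigenvalues₀ i.rev := fun hN i j hij =>
    neg_le_neg (hN.eigenvalues₀_antitone (Fin.rev_le_rev.2 hij))
  have h6 := sum_max_sub_le_levelExcess (hanti hM') (hanti hM)
  have h7 : ∑ i, |hZh.eigenvalues i| =
      ∑ i, max (hZh.eigenvalues i) 0 + ∑ i, max ((-hZh.eigenvalues) i) 0 := by
    rw [← Finset.sum_add_distrib]
    refine Finset.sum_congr rfl fun i _ => ?_
    rw [Pi.neg_apply]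
    grind
  rw [h7]
  exact add_le_add (h5.trans h1) (h6.trans h2)

/-- At levels `t ≥ 0` the mirrored half of a dilation's spectrum is not counted. -/
theorem levelCount_sumElim_neg {ι : Type} [Fintype ι] {x : ι → ℝ} (hx : ∀ i, 0 ≤ x i)
    {t : ℝ} (ht : 0 ≤ t) :
    levelCount (Sum.elim x (-x)) t = levelCount x t := by
  rw [levelCount_sumElim]
  have : IsEmpty {i // t < (-x) i} := ⟨fun i => by
    have h1 := i.2
    have h2 := hx i
    rw [Pi.neg_apply] at h1
    linarith⟩
  rw [levelCount, levelCount, Fintype.card_eq_zero (α := {i // t < (-x) i}), add_zero]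

theorem levelExcess_sumElim_neg {ι : Type} [Fintype ι] {x y : ι → ℝ} (hx : ∀ i, 0 ≤ x i)
    (hy : ∀ i, 0 ≤ y i) :
    levelExcess (Sum.elim x (-x)) (Sum.elim y (-y)) = levelExcess x y := by
  refine setIntegral_congr_fun measurableSet_Ici fun t ht => ?_
  simp only [levelCount_sumElim_neg hx ht, levelCount_sumElim_neg hy ht]

/-- The dilation of the error has spectrum `±e`, whose positive part has trace `∑ e`: exactly the
trace norm, with no factor two. -/
theorem sum_singularValue_le_traceNorm {n : ℕ} {A A' : Matrix (Fin n) (Fin n) ℂ} (hA : A.IsSymm)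
    (hA' : A'.IsSymm) {C : Matrix κ κ ℂ} (hC : C.IsSymm)
    {K : Matrix (Fin n ⊕ κ) (Fin n ⊕ κ) ℂ} (hK : (1 - K * Kᴴ).PosSemidef) :
    ∑ i ∈ Finset.range n, max (singularValue A' i - singularValue A i) 0 ≤
      traceNorm (fromBlocks A' 0 0 C - K * fromBlocks A 0 0 C * Kᵀ) := by
  set B := fromBlocks A 0 0 C with hB
  have hEs : (fromBlocks A' 0 0 C - K * B * Kᵀ).IsSymm := by
    have hBs : Bᵀ = B := by rw [hB, fromBlocks_transpose, hA.eq, hC.eq]; simp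
    rw [Matrix.IsSymm, transpose_sub, transpose_mul, transpose_mul, hBs, transpose_transpose,
      fromBlocks_transpose, hA'.eq, hC.eq, Matrix.mul_assoc]
    simp
  obtain ⟨U, hU⟩ := exists_takagiBy_singularValue hA
  obtain ⟨U', hU'⟩ := exists_takagiBy_singularValue hA'
  obtain ⟨V, c, hV⟩ := exists_takagiBy hC
  obtain ⟨W, e, hW⟩ := exists_takagiBy hEs
  have hx := hU'.fromBlocks hV
  have hy := hU.fromBlocks hV
  obtain ⟨P, hP⟩ := hx.hermitianDilation
  obtain ⟨Q, hQ⟩ := hy.hermitianDilation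
  obtain ⟨R, hR⟩ := hW.hermitianDilation
  have hKt : Kᴴᵀᴴ = Kᵀ := by
    ext i j; simp
  have hL : (1 - fromBlocks K 0 0 Kᴴᵀ * (fromBlocks K 0 0 Kᴴᵀ)ᴴ).PosSemidef := by
    have h : 1 - fromBlocks K 0 0 Kᴴᵀ * (fromBlocks K 0 0 Kᴴᵀ)ᴴ =
        fromBlocks (1 - K * Kᴴ) 0 0 (1 - K * Kᴴ)ᵀ := by
      rw [fromBlocks_conjTranspose, fromBlocks_multiply, ← fromBlocks_one, hKt, transpose_sub,
        transpose_mul, fromBlocks_sub_fromBlocks]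
      simp
    rw [h]
    exact posSemidef_fromBlocks_diagonal hK hK.transpose
  have key := levelExcess_le hP hQ hR hL (by
    rw [hermitianDilation_sub, hermitianDilation_mul_mul_transpose]; abel)
  rw [levelExcess_sumElim_neg hx.2.2.1 hy.2.2.1, levelExcess_sumElim] at key
  have h1 : ∑ i, max (Sum.elim e (-e) i) 0 = ∑ i, e i := by
    rw [Fintype.sum_sum_type]
    simp [hW.2.2.1]
  rw [h1, ← traceNorm_eq_sum hW.2.2.1 hW.diagonalizedBy] at key
  refine le_trans (le_of_eq ?_) ((sum_max_sub_le_levelExcess ?_ ?_).trans key)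
  · rw [← Fin.sum_univ_eq_sum_range (fun i => max (singularValue A' i - singularValue A i) 0)]
    refine Finset.sum_congr rfl fun i _ => ?_
    rw [max_eq_left (hU'.2.2.1 i), max_eq_left (hU.2.2.1 i)]
  · exact fun i j hij => LinearMap.singularValues_antitone _ hij
  · exact fun i j hij => LinearMap.singularValues_antitone _ hij

end LowerBound

/-! ### Covariance matrices of simple states. -/

section States

variable {ι κ : Type} [Fintype ι] [DecidableEq ι] [Fintype κ] [DecidableEq κ]

theorem IsCovarianceMatrix.directSum {σ : PhaseMatrix ι} {τ : PhaseMatrix κ}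
    (hσ : IsCovarianceMatrix σ) (hτ : IsCovarianceMatrix τ) :
    IsCovarianceMatrix (GaussianThermal.directSum σ τ) := by
  refine ⟨?_, ?_⟩
  · rw [Matrix.IsSymm, directSum_transpose, hσ.1.eq, hτ.1.eq]
  · have h := (posSemidef_fromBlocks_diagonal hσ.2 hτ.2).submatrix
      (Equiv.sumSumSumComm ι ι κ κ).symm
    convert h using 1
    ext ((i | i) | (i | i)) ((j | j) | (j | j)) <;>
      simp [GaussianThermal.directSum, symplecticForm, one_apply]

theorem half_le_thermalVariance {β ω : ℝ} (hβ : 0 < β) (hω : 0 < ω) :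
    1 / 2 ≤ thermalVariance β ω := by
  have h : 1 < Real.exp (β * ω) := Real.one_lt_exp_iff.2 (mul_pos hβ hω)
  rw [thermalVariance]
  have : 1 ≤ (Real.exp (β * ω) + 1) / (Real.exp (β * ω) - 1) := by
    rw [le_div_iff₀ (by linarith)]
    linarith
  linarith

/-- `c + (i/2) Ω = (c - 1/2) + (1 + i Ω)/2`, and both terms are positive semidefinite. -/
theorem isCovarianceMatrix_modeDiagonal_const {c : ℝ} (hc : 1 / 2 ≤ c) :
    IsCovarianceMatrix (modeDiagonal fun _ : ι => c) := by
  refine ⟨isSymm_diagonal _, ?_⟩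
  have h1 : ((modeRow ι)ᴴ * modeRow ι).PosSemidef := posSemidef_conjTranspose_mul_self _
  have h2 : (1 : Matrix (ι ⊕ ι) (ι ⊕ ι) ℂ).PosSemidef := PosSemidef.one
  have h3 := (h2.smul (a := ((c - 1 / 2 : ℝ) : ℂ)) (by
    rw [Complex.zero_le_real]; linarith)).add (h1.smul (a := (1 / 2 : ℂ)) (by
      rw [show (1 / 2 : ℂ) = ((1 / 2 : ℝ) : ℂ) by push_cast; rfl, Complex.zero_le_real]
      norm_num))
  convert h3 using 1
  rw [conjTranspose_mul_modeRow]
  ext (i | i) (j | j) <;> rcases eq_or_ne i j with rfl | h <;>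
    simp_all [modeDiagonal, symplecticForm, J] <;> ring

theorem mMatrix_directSum (β ω : ℝ) (σ : PhaseMatrix ι) (τ : PhaseMatrix κ) :
    mMatrix β ω (directSum σ τ) = fromBlocks (mMatrix β ω σ) 0 0 (mMatrix β ω τ) := by
  rw [mMatrix_eq, mMatrix_eq, mMatrix_eq, hMatrix_directSum, ← fromBlocks_one, fromBlocks_smul,
    fromBlocks_sub_fromBlocks]
  simp

theorem mMatrix_thermal (β ω : ℝ) :
    mMatrix β ω (modeDiagonal fun _ : ι => thermalVariance β ω) = 0 := by
  rw [mMatrix_eq, hMatrix_modeDiagonal, sub_eq_zero]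
  ext i j
  simp [diagonal_apply, one_apply]

theorem IsMMatrix.fromBlocks {β ω : ℝ} {M : Matrix ι ι ℂ} {C : Matrix κ κ ℂ}
    (hM : IsMMatrix β ω M) (hC : IsMMatrix β ω C) :
    IsMMatrix β ω (Matrix.fromBlocks M 0 0 C) := by
  obtain ⟨σ, hσ, rfl⟩ := hM
  obtain ⟨τ, hτ, rfl⟩ := hC
  exact ⟨directSum σ τ, hσ.directSum hτ, mMatrix_directSum β ω σ τ⟩

theorem IsAMatrix.fromBlocks {A : Matrix ι ι ℂ} {C : Matrix κ κ ℂ}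
    (hA : IsAMatrix A) (hC : IsAMatrix C) : IsAMatrix (Matrix.fromBlocks A 0 0 C) := by
  obtain ⟨σ, hσ, rfl⟩ := hA
  obtain ⟨τ, hτ, rfl⟩ := hC
  exact ⟨directSum σ τ, hσ.directSum hτ, aMatrix_directSum σ τ⟩

theorem isMMatrix_zero {β ω : ℝ} (hβ : 0 < β) (hω : 0 < ω) :
    IsMMatrix β ω (0 : Matrix ι ι ℂ) :=
  ⟨_, isCovarianceMatrix_modeDiagonal_const (half_le_thermalVariance hβ hω), mMatrix_thermal β ω⟩

theorem isAMatrix_zero : IsAMatrix (0 : Matrix ι ι ℂ) :=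
  ⟨_, isCovarianceMatrix_modeDiagonal_const le_rfl, aMatrix_modeDiagonal _⟩

theorem IsAMatrix.isSymm {A : Matrix ι ι ℂ} (hA : IsAMatrix A) : A.IsSymm := by
  obtain ⟨σ, hσ, rfl⟩ := hA
  have h : ∀ a b, σ a b = σ b a := fun a b => hσ.1.apply b a
  ext i j
  simp only [transpose_apply, aMatrix, of_apply]
  rw [h (Sum.inl j) (Sum.inl i), h (Sum.inr j) (Sum.inr i), h (Sum.inl j) (Sum.inr i),
    h (Sum.inr j) (Sum.inl i), add_comm (σ (Sum.inr i) (Sum.inl j))]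

end States

/-! ### Optimal transformations. -/

section Achievability

variable {ι : Type} [Fintype ι] [DecidableEq ι] {β ω : ℝ}

/-- Shrinking the eigenvalues and rotating the eigenvectors is a Gaussian thermal operation. -/
theorem IsMMatrix.mTransforms (hω : 0 < ω) {M V M' V' : Matrix ι ι ℂ} {x d : ι → ℝ}
    (hM : IsMMatrix β ω M) (h : DiagonalizedBy M V x) (h' : DiagonalizedBy M' V' d)
    (hd : ∀ i, |d i| ≤ |x i|) (hd' : ∀ i, 0 ≤ d i * x i) : MTransforms β ω M M' := by
  obtain ⟨σ, hσ, rfl⟩ := hM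
  have hq : ∀ i, 0 ≤ d i / x i := fun i => by
    rw [div_eq_mul_inv, ← mul_self_mul_inv (x i)⁻¹, inv_inv, mul_comm _ (x i), ← mul_assoc]
    exact mul_nonneg (hd' i) (mul_self_nonneg _)
  have hc : ∀ i, √(d i / x i) ^ 2 ≤ 1 := fun i => by
    rw [Real.sq_sqrt (hq i)]
    refine (le_abs_self _).trans ?_
    rw [abs_div]
    exact div_le_one_of_le₀ (hd i) (abs_nonneg _)
  -- The contraction is `V' √(d/x) Vᴴ`. Where `x i = 0` also `d i = 0`, and the convention `0 / 0 =
  -- 0` is harmless.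
  obtain ⟨σ', hG, hm, -⟩ := exists_GTO_of_contraction (β := β) hω σ h'.1
    (W := Vᴴ) (by rw [conjTranspose_conjTranspose, h.2.1]) hc
  refine ⟨σ, σ', hσ, rfl, ?_, hG⟩
  rw [hm, h'.2.2]
  conv_lhs => rw [h.2.2]
  set D := diagonal (fun i => ((√(d i / x i) : ℝ) : ℂ)) with hD
  have hDH : Dᴴ = D := diagonal_ofReal_conjTranspose _
  calc V' * D * Vᴴ * (V * diagonal (fun i => (x i : ℂ)) * Vᴴ) * (V' * D * Vᴴ)ᴴ
      = V' * (D * (Vᴴ * V) * diagonal (fun i => (x i : ℂ)) * (Vᴴ * V) * D) * V'ᴴ := by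
        simp only [conjTranspose_mul, conjTranspose_conjTranspose, hDH, Matrix.mul_assoc]
    _ = _ := by
        rw [h.2.1, Matrix.mul_one, Matrix.mul_one, hD, diagonal_mul_diagonal,
          diagonal_mul_diagonal]
        congr
        ext i
        rw [← Complex.ofReal_mul, ← Complex.ofReal_mul, mul_right_comm, Real.mul_self_sqrt (hq i)]
        congr 1
        refine div_mul_cancel_of_imp fun h0 => ?_
        simpa [h0] using hd i

/-- The contraction `U' √(d/x) Uᴴ` acts by congruence with its transpose, so it rescales Takagi
coefficients and replaces the Takagi basis. -/
theorem IsAMatrix.aTransforms (hω : 0 < ω) {A U A' U' : Matrix ι ι ℂ} {x d : ι → ℝ}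
    (hA : IsAMatrix A) (h : TakagiBy A U x) (h' : TakagiBy A' U' d)
    (hd : ∀ i, d i ≤ x i) : ATransforms β ω A A' := by
  obtain ⟨σ, hσ, rfl⟩ := hA
  have hq : ∀ i, 0 ≤ d i / x i := fun i => div_nonneg (h'.2.2.1 i) (h.2.2.1 i)
  have hc : ∀ i, √(d i / x i) ^ 2 ≤ 1 := fun i => by
    rw [Real.sq_sqrt (hq i)]
    exact div_le_one_of_le₀ (hd i) (h.2.2.1 i)
  obtain ⟨σ', hG, -, hm⟩ := exists_GTO_of_contraction (β := β) hω σ h'.1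
    (W := Uᴴ) (by rw [conjTranspose_conjTranspose, h.2.1]) hc
  refine ⟨σ, σ', hσ, rfl, ?_, hG⟩
  rw [hm, h'.2.2.2]
  conv_lhs => rw [h.2.2.2]
  set D := diagonal (fun i => ((√(d i / x i) : ℝ) : ℂ)) with hD
  have hDT : Dᵀ = D := diagonal_transpose _
  calc U' * D * Uᴴ * (U * diagonal (fun i => (x i : ℂ)) * Uᵀ) * (U' * D * Uᴴ)ᵀ
      = U' * (D * (Uᴴ * U) * diagonal (fun i => (x i : ℂ)) * (Uᵀ * Uᴴᵀ) * D) * U'ᵀ := by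
        simp only [transpose_mul, hDT, Matrix.mul_assoc]
    _ = _ := by
        rw [h.2.1, transpose_mul_conjTranspose_transpose h.2.1, Matrix.mul_one, Matrix.mul_one,
          hD, diagonal_mul_diagonal, diagonal_mul_diagonal]
        congr
        ext i
        rw [← Complex.ofReal_mul, ← Complex.ofReal_mul, mul_right_comm, Real.mul_self_sqrt (hq i)]
        congr 1
        exact div_mul_cancel_of_imp fun h0 => le_antisymm (by simpa [h0] using hd i) (h'.2.2.1 i)

/-- The real number closest to `y` that lies between `0` and `x`. -/
noncomputable def clip (y x : ℝ) : ℝ :=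
  min (max y 0) (max x 0) - min (max (-y) 0) (max (-x) 0)

theorem abs_clip_le (y x : ℝ) : |clip y x| ≤ |x| := by
  rw [clip]
  grind

theorem clip_mul_nonneg (y x : ℝ) : 0 ≤ clip y x * x := by
  rw [clip]
  rcases le_total 0 x with h | h
  · refine mul_nonneg ?_ h
    grind
  · refine mul_nonneg_of_nonpos_of_nonpos ?_ h
    grind

theorem abs_sub_clip (y x : ℝ) : |y - clip y x| =
    max (max y 0 - max x 0) 0 + max (max (-y) 0 - max (-x) 0) 0 := by
  rw [clip]
  grind

/-- The criterion is the distance from the target spectrum to the closest one reachable eigenvalue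
by eigenvalue, which is the trace-norm error of an explicit operation. -/
theorem sum_mu_eq {M M' : Matrix ι ι ℂ} (hM : M.IsHermitian) (hM' : M'.IsHermitian) :
    ∑ i, max (muPlus hM' i - muPlus hM i) 0 + ∑ i, max (muMinus hM' i - muMinus hM i) 0 =
      ∑ i, |hM'.eigenvalues i - clip (hM'.eigenvalues i) (hM.eigenvalues i)| := by
  simp only [abs_sub_clip, Finset.sum_add_distrib]
  let e : Fin (Fintype.card ι) ≃ ι := Fintype.equivOfCardEq (Fintype.card_fin _)
  congr 1
  · exact (e.symm.sum_comp fun i => max (muPlus hM' i - muPlus hM i) 0).symm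
  · refine ((e.symm.trans Fin.revPerm).sum_comp
      fun i => max (muMinus hM' i - muMinus hM i) 0).symm.trans ?_
    refine Finset.sum_congr rfl fun i _ => ?_
    simp [muMinus, IsHermitian.eigenvalues, e]

end Achievability

/-! ### Catalysis criteria and absence of embezzlement. -/

section Catalysis

variable {β ω : ℝ}

theorem strongCatalyticM_iff (hβ : 0 < β) (hω : 0 < ω) {ι : Type} [Fintype ι] [DecidableEq ι]
    {M M' : Matrix ι ι ℂ} (hM : IsMMatrix β ω M) (hM' : IsMMatrix β ω M') (δ : ℝ) :
    StrongCatalyticM β ω δ M M' ↔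
      ∑ i, max (muPlus hM'.isHermitian i - muPlus hM.isHermitian i) 0
        + ∑ i, max (muMinus hM'.isHermitian i - muMinus hM.isHermitian i) 0 ≤ δ := by
  constructor
  · rintro ⟨m, -, C, hC, N, ⟨σ, σ', -, hm, rfl, hG⟩, hδ⟩
    obtain ⟨K, hK, hm', -⟩ := hG.exists_contraction hω
    rw [hm', hm] at hδ
    exact (sum_mu_le_traceNorm hM.isHermitian hM'.isHermitian hC.isHermitian hK).trans hδ
  · intro hδ
    rw [sum_mu_eq] at hδ
    have h := hM.isHermitian.diagonalizedBy
    have h' := hM'.isHermitian.diagonalizedBy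
    set x := hM.isHermitian.eigenvalues
    set x' := hM'.isHermitian.eigenvalues
    set V' := hM'.isHermitian.eigenvectorUnitary.1
    have h0 : DiagonalizedBy (0 : Matrix (Fin 1) (Fin 1) ℂ) 1 0 := ⟨by simp, by simp, by simp⟩
    have hd : DiagonalizedBy (V' * diagonal (fun i => (clip (x' i) (x i) : ℂ)) * V'ᴴ) V'
      (fun i => clip (x' i) (x i)) := ⟨h'.1, h'.2.1, rfl⟩
    have hs : DiagonalizedBy (M' - V' * diagonal (fun i => (clip (x' i) (x i) : ℂ)) * V'ᴴ) V'
        (fun i => x' i - clip (x' i) (x i)) := by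
      refine ⟨h'.1, h'.2.1, ?_⟩
      conv_lhs => rw [h'.2.2]
      rw [← Matrix.sub_mul, ← Matrix.mul_sub, diagonal_sub]
      congr
      ext i
      push_cast
      rfl
    -- One thermal mode serves as the required catalyst. The clipped matrix shares the eigenvectors
    -- of `M'`, so the error is diagonal in that basis.
    refine ⟨1, one_pos, 0, isMMatrix_zero hβ hω, _,
      (hM.fromBlocks (isMMatrix_zero hβ hω)).mTransforms hω (h.fromBlocks h0) (hd.fromBlocks h0)
        ?_ ?_, ?_⟩
    · rintro (i | i)
      exacts [abs_clip_le _ _, le_rfl]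
    · rintro (i | i)
      exacts [clip_mul_nonneg _ _, (mul_zero _).ge]
    · have := (hs.fromBlocks h0).traceNorm_eq
      rw [fromBlocks_sub_fromBlocks, sub_zero, sub_zero, sub_zero, this, Fintype.sum_sum_type]
      simpa using hδ

/-- A vanishing sum makes every target eigenvalue equal to its own clip, so the shrinking operation
reaches `M'` exactly. -/
theorem mTransforms_of_sum_mu_le_zero (hω : 0 < ω) {ι : Type} [Fintype ι] [DecidableEq ι]
    {M M' : Matrix ι ι ℂ} (hM : IsMMatrix β ω M) (hM' : IsMMatrix β ω M')
    (h : ∑ i, max (muPlus hM'.isHermitian i - muPlus hM.isHermitian i) 0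
        + ∑ i, max (muMinus hM'.isHermitian i - muMinus hM.isHermitian i) 0 ≤ 0) :
    MTransforms β ω M M' := by
  rw [sum_mu_eq] at h
  have h1 : ∀ i, hM'.isHermitian.eigenvalues i =
      clip (hM'.isHermitian.eigenvalues i) (hM.isHermitian.eigenvalues i) := fun i => by
    have := (Finset.sum_eq_zero_iff_of_nonneg fun i _ => abs_nonneg _).1
      (h.antisymm (Finset.sum_nonneg fun i _ => abs_nonneg _)) i (Finset.mem_univ i)
    exact sub_eq_zero.1 (abs_eq_zero.1 this)
  refine hM.mTransforms hω hM.isHermitian.diagonalizedBy hM'.isHermitian.diagonalizedBy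
    (fun i => ?_) fun i => ?_
  · rw [h1]; exact abs_clip_le _ _
  · rw [h1]; exact clip_mul_nonneg _ _

theorem strongCatalyticA_iff (hω : 0 < ω) {n : ℕ} {A A' : Matrix (Fin n) (Fin n) ℂ}
    (hA : IsAMatrix A) (hA' : IsAMatrix A') (δ : ℝ) :
    StrongCatalyticA β ω δ A A' ↔
      ∑ i ∈ Finset.range n, max (singularValue A' i - singularValue A i) 0 ≤ δ := by
  constructor
  · rintro ⟨m, -, C, hC, N, ⟨σ, σ', -, ha, rfl, hG⟩, hδ⟩
    obtain ⟨K, hK, -, ha'⟩ := hG.exists_contraction hω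
    rw [ha', ha] at hδ
    exact (sum_singularValue_le_traceNorm hA.isSymm hA'.isSymm hC.isSymm hK).trans hδ
  · intro hδ
    obtain ⟨U, h⟩ := exists_takagiBy_singularValue hA.isSymm
    obtain ⟨U', h'⟩ := exists_takagiBy_singularValue hA'.isSymm
    rw [← Fin.sum_univ_eq_sum_range (fun i => max (singularValue A' i - singularValue A i) 0)]
      at hδ
    set x : Fin n → ℝ := fun i => singularValue A (i : ℕ) with hx
    set x' : Fin n → ℝ := fun i => singularValue A' (i : ℕ) with hx'
    have h0 : TakagiBy (0 : Matrix (Fin 1) (Fin 1) ℂ) 1 0 :=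
      ⟨by simp, by simp, fun _ => le_rfl, by simp⟩
    have hd : TakagiBy (U' * diagonal (fun i => ((min (x' i) (x i) : ℝ) : ℂ)) * U'ᵀ) U'
      (fun i => min (x' i) (x i)) :=
      ⟨h'.1, h'.2.1, fun i => le_min (h'.2.2.1 i) (h.2.2.1 i), rfl⟩
    have hs : TakagiBy (A' - U' * diagonal (fun i => ((min (x' i) (x i) : ℝ) : ℂ)) * U'ᵀ) U'
        (fun i => max (x' i - x i) 0) := by
      refine ⟨h'.1, h'.2.1, fun i => le_max_right _ _, ?_⟩
      conv_lhs => rw [h'.2.2.2]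
      rw [← Matrix.sub_mul, ← Matrix.mul_sub, diagonal_sub]
      congr
      ext i
      rw [← Complex.ofReal_sub]
      congr 1
      grind
    refine ⟨1, one_pos, 0, isAMatrix_zero, _,
      (hA.fromBlocks isAMatrix_zero).aTransforms hω (h.fromBlocks h0) (hd.fromBlocks h0) ?_, ?_⟩
    · rintro (i | i)
      exacts [min_le_right _ _, le_rfl]
    · have hE := hs.fromBlocks h0
      have := traceNorm_eq_sum hE.2.2.1 hE.diagonalizedBy
      rw [fromBlocks_sub_fromBlocks, sub_zero, sub_zero, sub_zero, this, Fintype.sum_sum_type]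
      simpa using hδ

theorem aTransforms_of_sum_singularValue_le_zero (hω : 0 < ω) {n : ℕ}
    {A A' : Matrix (Fin n) (Fin n) ℂ} (hA : IsAMatrix A) (hA' : IsAMatrix A')
    (h : ∑ i ∈ Finset.range n, max (singularValue A' i - singularValue A i) 0 ≤ 0) :
    ATransforms β ω A A' := by
  obtain ⟨U, hU⟩ := exists_takagiBy_singularValue hA.isSymm
  obtain ⟨U', hU'⟩ := exists_takagiBy_singularValue hA'.isSymm
  refine hA.aTransforms hω hU hU' fun i => ?_
  have := (Finset.sum_eq_zero_iff_of_nonneg fun i _ => le_max_right _ _).1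
    (h.antisymm (Finset.sum_nonneg fun i _ => le_max_right _ _)) i (Finset.mem_range.2 i.2)
  exact sub_nonpos.1 ((le_max_left _ _).trans this.le)

end Catalysis

end GaussianThermal

theorem theorem5 (β ω : ℝ) (hβ : 0 < β) (hω : 0 < ω) (n : ℕ) :
    (∀ (M M' : Matrix (Fin n) (Fin n) ℂ) (hM : IsMMatrix β ω M) (hM' : IsMMatrix β ω M') (δ : ℝ),
      StrongCatalyticM β ω δ M M' ↔
        ∑ i, max (muPlus hM'.isHermitian i - muPlus hM.isHermitian i) 0
          + ∑ i, max (muMinus hM'.isHermitian i - muMinus hM.isHermitian i) 0 ≤ δ) ∧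
    (∀ A A' : Matrix (Fin n) (Fin n) ℂ, IsAMatrix A → IsAMatrix A' → ∀ δ : ℝ,
      StrongCatalyticA β ω δ A A' ↔
        ∑ i ∈ Finset.range n, max (singularValue A' i - singularValue A i) 0 ≤ δ) ∧
    (∀ M M' : Matrix (Fin n) (Fin n) ℂ, IsMMatrix β ω M → IsMMatrix β ω M' →
      (∀ δ : ℝ, 0 < δ → StrongCatalyticM β ω δ M M') → MTransforms β ω M M') ∧
    (∀ A A' : Matrix (Fin n) (Fin n) ℂ, IsAMatrix A → IsAMatrix A' →
      (∀ δ : ℝ, 0 < δ → StrongCatalyticA β ω δ A A') → ATransforms β ω A A') := by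
  refine ⟨fun M M' hM hM' δ => strongCatalyticM_iff hβ hω hM hM' δ,
    fun A A' hA hA' δ => strongCatalyticA_iff hω hA hA' δ, fun M M' hM hM' h => ?_,
    fun A A' hA hA' h => ?_⟩
  -- The left side of the criterion does not depend on `δ` or on the catalyst, so being at most
  -- every `δ > 0` makes it at most zero.
  · exact mTransforms_of_sum_mu_le_zero hω hM hM' (le_of_forall_pos_le_add fun δ hδ => by
      rw [zero_add]; exact (strongCatalyticM_iff hβ hω hM hM' δ).1 (h δ hδ))
  · exact aTransforms_of_sum_singularValue_le_zero hω hA hA' (le_of_forall_pos_le_add fun δ hδ => by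
      rw [zero_add]; exact (strongCatalyticA_iff hω hA hA' δ).1 (h δ hδ))
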